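/- Let $\mathfrak g$ be a finite-dimensional complex simple Lie algebra with Killing form $\kappa$, let $\mathfrak h$ be a Cartan subalgebra, $\Delta$ the set of roots with root spaces $\mathfrak g_\alpha$, $\Delta^+$ a positive system with simple roots $\Pi$, and let $\alpha_{\mathfrak q}\in\Pi$. Let $H_{\mathfrak q}\in\mathfrak h$ be the element for which $\beta(H_{\mathfrak q})$ is the multiplicity of $\alpha_{\mathfrak q}$ in $\beta$ for every $\beta\in\Delta$, let $\mathfrak g(j)$ be the $j$-eigenspace of $\mathrm{ad}(H_{\mathfrak q})$, and put $\mathfrak l=\mathfrak g(0)$ and $\mathfrak n=\bigoplus_{j>0}\mathfrak g(j)$, so that $\mathfrak q=\mathfrak l\oplus\mathfrak n$ is the standard maximal parabolic subalgebra attached to $\alpha_{\mathfrak q}$. Assume that $\mathfrak q$ is of quasi-Heisenberg type: $[\mathfrak n,[\mathfrak n,\mathfrak n]]=0$ and $\dim[\mathfrak n,\mathfrak n]>1$. Then $\mathfrak g=\bigoplus_{j=-2}^{2}\mathfrak g(j)$ and $\mathfrak z(\mathfrak n)=\mathfrak g(2)$ is the centre of $\mathfrak n$. Let $L$ be the connected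 group with Lie algebra $\mathfrak l$. For an $\mathfrak l$-module, "highest weight vector" means a nonzero weight vector for $\mathfrak h$ annihilated by $\mathfrak g_\alpha$ for all positive roots $\alpha$ of $\mathfrak l$. Write $\Delta(\mathfrak g(j))=\{\alpha\in\Delta:\mathfrak g_\alpha\subset\mathfrak g(j)\}$. Choose root vectors $X_\alpha\in\mathfrak g_\alpha$ $(\alpha\in\Delta)$ with $\kappa(X_\alpha,X_{-\alpha})=1$, and define $$\tau_2:\mathfrak g(1)\to\mathfrak l\otimes\mathfrak z(\mathfrak n),\qquad \tau_2(X)=\tfrac12\sum_{\gamma_j\in\Delta(\mathfrak g(2))}\mathrm{ad}(X)^2X_{-\gamma_j}\otimes X_{\gamma_j}.$$ Let $\mathcal P^2(\mathfrak g(1))$ be the space of homogeneous polynomials of degree $2$ on $\mathfrak g(1)$, and let $\tilde\tau_2:(\mathfrak l\otimes\mathfrak z(\mathfrak n))^*\to\mathcal P^2(\mathfrak g(1))$ be the $L$-intertwining operator $\tilde\tau_2(Y^*)(X)=Y^*(\tau_2(X))$. For an irreducible $L$-submodule $V$ of $\mathfrak l\otimes\mathfrak z(\mathfrak n)$, let $V^*$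 denote the $L$-submodule of $(\mathfrak l\otimes\mathfrak z(\mathfrak n))^*$ dual to $V$, that is, the submodule that restriction of functionals to $V$ maps isomorphically onto the dual of $V$. Let $\mu$ and $\gamma$ be the highest weights of the irreducible $L$-modules $\mathfrak g(1)$ and $\mathfrak z(\mathfrak n)$. An irreducible constituent $V(\nu)\subset\mathfrak l\otimes\mathfrak z(\mathfrak n)$ with highest weight $\nu$ is called special if $\nu\ne\gamma$ and $\nu=\mu+\epsilon$ for some $\epsilon\in\Delta(\mathfrak g(1))$. A special constituent $V(\mu+\epsilon)$ is of type 1a if $\mu+\epsilon\notin\Delta$, $\epsilon\ne\mu$, and both $\mu$ and $\epsilon$ are long roots (all roots being long if $\mathfrak g$ is simply laced), and of type 2 if $\epsilon=\mu$ and $\mu+\epsilon=2\mu\notin\Delta$. **Proposition.** If $V(\mu+\epsilon)$ is a special constituent of $\mathfrak l\otimes\mathfrak z(\mathfrak n)$ of type 1a or type 2, then: 1. the vector $\tau_2(X_\mu+X_\epsilon)$ lies in $V(\mu+\epsilon)$ and is a highest weight vector for $V(\mu+\epsilon)$, of weight $\mu+\epsilon$; 2. the $L$-intertwining operator $\tilde\tau_2|_{V(\mu+\epsilon)^*}:V(\mu+\epsilon)^*\to\mathcal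 P^2(\mathfrak g(1))$ is not identically zero. -/

import Mathlib

open scoped TensorProduct

noncomputable section

namespace QuasiHeisenberg

open LieAlgebra LieAlgebra.IsKilling LieModule Module

variable {g : Type*} [LieRing g] [LieAlgebra ℂ g] [FiniteDimensional ℂ g] [IsSimple ℂ g]
variable {H : LieSubalgebra ℂ g} [H.IsCartanSubalgebra]

/-! ### The grading of a simple Lie algebra given by a simple root -/

/-- The element `H_q` of the Cartan subalgebra such that `β(H_q)` is the multiplicity of the
simple root `q` in `β`, for every root `β`. -/
def gradingElement (b : (rootSystem H).Base) (q : b.support) : H :=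
  (evalEquiv ℂ H).symm (b.toWeightBasis.coord q)

lemma root_gradingElement (b : (rootSystem H).Base) (q : b.support) (φ : Dual ℂ H) :
    φ (gradingElement b q) = b.toWeightBasis.repr φ q := by
  simp [gradingElement]

/-- The Levi subalgebra `l = g(0)`, i.e. the `0`-eigenspace of `ad H_q`. -/
def levi (b : (rootSystem H).Base) (q : b.support) : LieSubalgebra ℂ g where
  carrier := {x | ⁅(gradingElement b q : g), x⁆ = 0}
  zero_mem' := lie_zero _
  add_mem' := by
    intro x y hx hy
    change ⁅(gradingElement b q : g), x⁆ = 0 at hx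
    change ⁅(gradingElement b q : g), y⁆ = 0 at hy
    change ⁅(gradingElement b q : g), x + y⁆ = 0
    rw [lie_add, hx, hy, add_zero]
  smul_mem' := by
    intro c x hx
    change ⁅(gradingElement b q : g), x⁆ = 0 at hx
    change ⁅(gradingElement b q : g), c • x⁆ = 0
    rw [lie_smul, hx, smul_zero]
  lie_mem' := by
    intro x y hx hy
    change ⁅(gradingElement b q : g), x⁆ = 0 at hx
    change ⁅(gradingElement b q : g), y⁆ = 0 at hy
    change ⁅(gradingElement b q : g), ⁅x, y⁆⁆ = 0
    rw [leibniz_lie, hx, hy, zero_lie, lie_zero, add_zero]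

lemma mem_levi {b : (rootSystem H).Base} {q : b.support} {x : g} :
    x ∈ levi b q ↔ ⁅(gradingElement b q : g), x⁆ = 0 := Iff.rfl

/-- The graded piece `g(j)`: the `j`-eigenspace of `ad H_q`, as a module over `l = g(0)`. -/
def piece (b : (rootSystem H).Base) (q : b.support) (j : ℤ) : LieSubmodule ℂ (levi b q) g where
  carrier := {x | ⁅(gradingElement b q : g), x⁆ = (j : ℂ) • x}
  zero_mem' := by simp
  add_mem' := by
    intro x y hx hy
    change ⁅(gradingElement b q : g), x⁆ = (j : ℂ) • x at hx
    change ⁅(gradingElement b q : g), y⁆ = (j : ℂ) • y at hy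
    change ⁅(gradingElement b q : g), x + y⁆ = (j : ℂ) • (x + y)
    rw [lie_add, hx, hy, smul_add]
  smul_mem' := by
    intro c x hx
    change ⁅(gradingElement b q : g), x⁆ = (j : ℂ) • x at hx
    change ⁅(gradingElement b q : g), c • x⁆ = (j : ℂ) • (c • x)
    rw [lie_smul, hx, smul_comm]
  lie_mem := by
    intro z x hx
    change ⁅(gradingElement b q : g), x⁆ = (j : ℂ) • x at hx
    change ⁅(gradingElement b q : g), ⁅(z : g), x⁆⁆ = (j : ℂ) • ⁅(z : g), x⁆
    rw [leibniz_lie, mem_levi.1 z.2, hx, zero_lie, lie_smul, zero_add]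

lemma mem_piece {b : (rootSystem H).Base} {q : b.support} {j : ℤ} {x : g} :
    x ∈ piece b q j ↔ ⁅(gradingElement b q : g), x⁆ = (j : ℂ) • x := Iff.rfl

lemma lie_mem_piece {b : (rootSystem H).Base} {q : b.support} {i j : ℤ} {x y : g}
    (hx : x ∈ piece b q i) (hy : y ∈ piece b q j) : ⁅x, y⁆ ∈ piece b q (i + j) := by
  rw [mem_piece] at hx hy ⊢
  rw [leibniz_lie, hx, hy, smul_lie, lie_smul, ← add_smul, Int.cast_add]

/-- The nilpotent radical `n = ⨁_{j > 0} g(j)` of the standard maximal parabolic subalgebra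
`q = l ⊕ n` attached to the simple root `q`. -/
def nilradical (b : (rootSystem H).Base) (q : b.support) : LieSubalgebra ℂ g where
  __ := ⨆ j : ℕ, (piece b q (j + 1)).toSubmodule
  lie_mem' := by
    intro x y hx hy
    change x ∈ (⨆ j : ℕ, (piece b q (j + 1)).toSubmodule) at hx
    change y ∈ (⨆ j : ℕ, (piece b q (j + 1)).toSubmodule) at hy
    change ⁅x, y⁆ ∈ (⨆ j : ℕ, (piece b q (j + 1)).toSubmodule)
    induction hx using Submodule.iSup_induction' with
    | zero => simp
    | add x₁ x₂ _ _ h₁ h₂ => rw [add_lie]; exact add_mem h₁ h₂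
    | mem i x hx =>
      induction hy using Submodule.iSup_induction' with
      | zero => simp
      | add y₁ y₂ _ _ h₁ h₂ => rw [lie_add]; exact add_mem h₁ h₂
      | mem j y hy =>
        refine Submodule.mem_iSup_of_mem (i + j + 1) ?_
        have := lie_mem_piece (i := i + 1) (j := j + 1) hx hy
        have e : ((i : ℤ) + 1) + ((j : ℤ) + 1) = ((i + j + 1 : ℕ) : ℤ) + 1 := by push_cast; ring
        rw [e] at this
        exact this

/-- A Lie algebra `r` is quasi-Heisenberg if `[r, [r, r]] = 0` and `dim [r, r] > 1`. -/
def IsQuasiHeisenberg (r : Type*) [LieRing r] [LieAlgebra ℂ r] : Prop :=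
  ⁅(⊤ : LieIdeal ℂ r), ⁅(⊤ : LieIdeal ℂ r), (⊤ : LieIdeal ℂ r)⁆⁆ = ⊥ ∧
    1 < finrank ℂ (⁅(⊤ : LieIdeal ℂ r), (⊤ : LieIdeal ℂ r)⁆ : LieIdeal ℂ r)

/-- `Δ(g(j))`: the roots `α` with `g_α ⊆ g(j)`. -/
def rootsOfPiece (b : (rootSystem H).Base) (q : b.support) (j : ℤ) : Set H.root :=
  {α | (rootSpace H (α : Weight ℂ H g)).toSubmodule ≤ (piece b q j).toSubmodule}

/-! ### Root vectors -/

/-- A choice of root vectors `X_α ∈ g_α`, one for each root `α`, normalized by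
`κ(X_α, X_{-α}) = 1`, where `κ` is the Killing form. -/
structure RootVectors (H : LieSubalgebra ℂ g) [H.IsCartanSubalgebra] where
  vec : Weight ℂ H g → g
  vec_mem : ∀ α : Weight ℂ H g, α.IsNonZero → vec α ∈ rootSpace H α
  killing : ∀ α : Weight ℂ H g, α.IsNonZero → killingForm ℂ g (vec α) (vec (-α)) = 1

lemma RootVectors.vec_ne_zero (X : RootVectors H) {α : Weight ℂ H g} (hα : α.IsNonZero) :
    X.vec α ≠ 0 := by
  intro h
  have := X.killing α hα
  simp [h] at this

/-- The root vector `X_α` as an element of `g(j)`, for `α ∈ Δ(g(j))`. -/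
def RootVectors.inPiece (X : RootVectors H) {b : (rootSystem H).Base} {q : b.support} {j : ℤ}
    {α : H.root} (hα : α ∈ rootsOfPiece b q j) : piece b q j :=
  ⟨X.vec α, hα (X.vec_mem α (H.isNonZero_coe_root α))⟩

lemma RootVectors.vec_neg_mem_piece (X : RootVectors H) {b : (rootSystem H).Base} {q : b.support}
    {j : ℤ} {α : H.root} (hα : α ∈ rootsOfPiece b q j) : X.vec (-α) ∈ piece b q (-j) := by
  have h0 := H.isNonZero_coe_root α
  have h1 := lie_eq_smul_of_mem_rootSpace (X.vec_mem α h0) (gradingElement b q)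
  have h2 : ⁅(gradingElement b q : g), X.vec α⁆ = (j : ℂ) • X.vec α :=
    hα (X.vec_mem α h0)
  have h3 : (α : Weight ℂ H g) (gradingElement b q) = (j : ℂ) := by
    have h4 : (α : Weight ℂ H g) (gradingElement b q) • X.vec α = (j : ℂ) • X.vec α := by
      rw [← h1, ← h2]; rfl
    exact smul_left_injective ℂ (X.vec_ne_zero h0) h4
  have h5 := lie_eq_smul_of_mem_rootSpace (X.vec_mem (-α) h0.neg) (gradingElement b q)
  rw [mem_piece]
  change ⁅(gradingElement b q : g), X.vec (-α)⁆ = _ at h5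
  rw [h5]
  simp [h3]

/-! ### The covariant map `τ₂` and the operator it induces -/

/-- The `l`-module `l ⊗ z(n) = g(0) ⊗ g(2)`. -/
abbrev LeviTensor (b : (rootSystem H).Base) (q : b.support) : Type _ :=
  levi b q ⊗[ℂ] piece b q 2

lemma lie_lie_mem_levi {b : (rootSystem H).Base} {q : b.support} {x y z : g}
    (hx : x ∈ piece b q 1) (hy : y ∈ piece b q 1) (hz : z ∈ piece b q (-2)) :
    ⁅x, ⁅y, z⁆⁆ ∈ levi b q := by
  have := mem_piece.1 (lie_mem_piece hx (lie_mem_piece hy hz))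
  rw [mem_levi, this]
  norm_num

/-- For `z ∈ g(-2)`, the bilinear map `g(1) × g(1) → l`, `(x, y) ↦ ad(x) ad(y) z`. -/
def adAd {b : (rootSystem H).Base} {q : b.support} (z : piece b q (-2)) :
    LinearMap.BilinMap ℂ (piece b q 1) (levi b q) :=
  LinearMap.mk₂ ℂ
    (fun x y ↦ (⟨⁅(x : g), ⁅(y : g), (z : g)⁆⁆, lie_lie_mem_levi x.2 y.2 z.2⟩ : levi b q))
    (by intros; ext; simp [add_lie])
    (by intros; ext; simp)
    (by intros; ext; simp [lie_add])
    (by intros; ext; simp)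

open Classical in
/-- The covariant map `τ₂ : g(1) → l ⊗ z(n)`, `τ₂(x) = (1/2) (ad(x)² ⊗ Id) ω`, with
`ω = ∑_{γ ∈ Δ(z(n))} X_{-γ} ⊗ X_γ`, as a quadratic map; `tau2_apply` is the formula. -/
def tau2 (X : RootVectors H) (b : (rootSystem H).Base) (q : b.support) :
    QuadraticMap ℂ (piece b q 1) (LeviTensor b q) :=
  LinearMap.BilinMap.toQuadraticMap <| (1 / 2 : ℂ) • ∑ γ : rootsOfPiece b q 2,
    (adAd ⟨X.vec (-(γ : H.root)), X.vec_neg_mem_piece γ.2⟩).compr₂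
      ((TensorProduct.mk ℂ (levi b q) (piece b q 2)).flip (X.inPiece γ.2))

open Classical in
lemma tau2_apply (X : RootVectors H) (b : (rootSystem H).Base) (q : b.support) (x : piece b q 1) :
    tau2 X b q x = (1 / 2 : ℂ) • ∑ γ : rootsOfPiece b q 2,
      (⟨⁅(x : g), ⁅(x : g), X.vec (-(γ : H.root))⁆⁆,
        lie_lie_mem_levi x.2 x.2 (X.vec_neg_mem_piece γ.2)⟩ : levi b q) ⊗ₜ[ℂ] X.inPiece γ.2 := by
  simp [tau2, adAd]

/-- The operator `τ̃₂ : (l ⊗ z(n))* → P²(g(1))`, `τ̃₂(Y)(x) = Y(τ₂(x))`, where homogeneous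
polynomials of degree two on `g(1)` are quadratic forms on `g(1)`. -/
def tau2Tilde (X : RootVectors H) (b : (rootSystem H).Base) (q : b.support) :
    Dual ℂ (LeviTensor b q) →ₗ[ℂ] QuadraticForm ℂ (piece b q 1) where
  toFun Y := Y.compQuadraticMap (tau2 X b q)
  map_add' _ _ := rfl
  map_smul' _ _ := rfl

/-! ### Highest weights and special constituents -/

section HighestWeight

variable (b : (rootSystem H).Base) (q : b.support)
variable {M : Type*} [AddCommGroup M] [Module ℂ M] [LieRingModule (levi b q) M]

/-- `v` is a highest weight vector of weight `ν` in the `l`-module `M`: it is nonzero, `H ⊆ l`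
acts on it through `ν`, and it is annihilated by `g_α` for every positive root `α` of `l`.
(For a root `α` that is not a root of `l`, the only element of `l` in `g_α` is zero.) -/
structure IsHighestWeightVector (v : M) (ν : Dual ℂ H) : Prop where
  ne_zero : v ≠ 0
  weight : ∀ (z : levi b q) (h : H), (z : g) = h → ⁅z, v⁆ = ν h • v
  annihilated : ∀ (z : levi b q) (α : H.root), b.IsPos α →
    (z : g) ∈ rootSpace H (α : Weight ℂ H g) → ⁅z, v⁆ = 0

variable (M) in
/-- `ν` is the highest weight of the (irreducible) `l`-module `M`. -/
def HasHighestWeight (ν : Dual ℂ H) : Prop := ∃ v : M, IsHighestWeightVector b q v ν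

end HighestWeight

/-- The `l`-submodule `V` of `l ⊗ z(n)` is a special constituent `V(μ + ε)`: it is irreducible
with highest weight `μ + ε`, where `μ ∈ Δ(g(1))` is the highest weight of `g(1)`, `ε ∈ Δ(g(1))`,
and `μ + ε ≠ γ`, the highest weight of `z(n) = g(2)`. -/
structure IsSpecialConstituent (b : (rootSystem H).Base) (q : b.support)
    (V : LieSubmodule ℂ (levi b q) (LeviTensor b q)) (μ ε γ : H.root) : Prop where
  highest_one : HasHighestWeight b q (piece b q 1) ((rootSystem H).root μ)
  mu_mem : μ ∈ rootsOfPiece b q 1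
  eps_mem : ε ∈ rootsOfPiece b q 1
  highest_two : HasHighestWeight b q (piece b q 2) ((rootSystem H).root γ)
  irreducible : LieModule.IsIrreducible ℂ (levi b q) V
  highest : HasHighestWeight b q V ((rootSystem H).root μ + (rootSystem H).root ε)
  ne : (rootSystem H).root μ + (rootSystem H).root ε ≠ (rootSystem H).root γ

/-- The square of the length of a root with respect to the form on the dual of the Cartan
subalgebra corresponding to the Killing form. (Its value is a positive real number.) -/
def rootNormSq (α : H.root) : ℝ :=
  (killingForm ℂ g ((cartanEquivDual H).symm ((rootSystem H).root α))
    ((cartanEquivDual H).symm ((rootSystem H).root α))).re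

/-- A root is long if no root is longer; if all roots have the same length, all are long. -/
def IsLong (α : H.root) : Prop := ∀ β : H.root, rootNormSq β ≤ rootNormSq α

/-- Type 1a: `μ + ε` is not a root, `ε ≠ μ`, and both `μ` and `ε` are long. -/
def IsType1a (μ ε : H.root) : Prop :=
  (rootSystem H).root μ + (rootSystem H).root ε ∉ Set.range (rootSystem H).root ∧
    ε ≠ μ ∧ IsLong μ ∧ IsLong ε

/-- Type 2: `μ + ε = 2μ` is not a root. -/
def IsType2 (μ ε : H.root) : Prop :=
  (rootSystem H).root μ + (rootSystem H).root ε ∉ Set.range (rootSystem H).root ∧ ε = μ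

/-- The submodule `V'` of the dual module `(l ⊗ z(n))*` is the constituent `V*` dual to `V`:
restricting functionals to `V` is an isomorphism from `V'` onto the dual space of `V`. -/
def IsDualConstituent {b : (rootSystem H).Base} {q : b.support}
    (V : LieSubmodule ℂ (levi b q) (LeviTensor b q))
    (V' : LieSubmodule ℂ (levi b q) (Dual ℂ (LeviTensor b q))) : Prop :=
  Function.Bijective
    ((Submodule.dualRestrict V.toSubmodule).comp V'.toSubmodule.subtype)

end QuasiHeisenberg

end

open scoped TensorProduct

noncomputable section

namespace QuasiHeisenberg

open LieAlgebra LieAlgebra.IsKilling LieModule Module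

variable {g : Type*} [LieRing g] [LieAlgebra ℂ g] [FiniteDimensional ℂ g] [IsSimple ℂ g]
variable {H : LieSubalgebra ℂ g} [H.IsCartanSubalgebra]

set_option linter.unusedSectionVars false

/-! ### Brackets of root vectors -/

/-! Write T = τ₂(X_μ + X_ε) and ⟨α, β^∨⟩ for `pairingIn ℤ α β`. An element of l ⊗ z(n) is studied
through its contractions with u ∈ g(-2) by the Killing form (`coeff`); that of T is ½ ad(X_μ + X_ε)²
u. This is a nonzero scalar times ad(X_μ) ad(X_ε) u: in type 2 because ε = μ, and in type 1a because
X_μ and X_ε commute while the squares ad(X_μ)² and ad(X_ε)² kill g(-2), the roots μ and ε being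
long.

T is a highest weight vector. Its weight is clear. For a positive root α of l and z ∈ g_α, the
contraction of z·T involves ad([z, X_μ]) ad(X_ε) u and ad(X_μ) ad([z, X_ε]) u. The first vanishes
because μ is highest in g(1), and so does the second in type 2. In type 1a the second needs root
combinatorics: if ε + α is a root, then ⟨μ, α^∨⟩ > 0 (`pairingIn_pos_of_isType1a`), and the weight
of the second expression would then be a root of degree 0 pairing too strongly with the long root μ
(`lie_lie_lie_eq_zero_of_isType1a`).

T is nonzero and lies in V. A vector killed by the positive root vectors of l is determined by its
contraction with X_{-γ} (`eq_zero_of_coeff_highest_eq_zero`), because γ is the only root of z(n)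
that cannot be raised inside l: such a root is highest in Δ, all degrees being at most 2. For a
highest weight vector of V this contraction is nonzero of weight μ + ε - γ ≠ 0, so β = μ + ε - γ is
a root. As g_β is a line, weight μ + ε occurs at most once among highest weight vectors, whence T ∈
V as soon as T ≠ 0; and T ≠ 0 because ε - γ and β are both roots, so that ad(X_μ) ad(X_ε) X_{-γ} ≠
0.

The second assertion follows by evaluating at X_μ + X_ε: some functional in V* does not vanish on T.
-/

lemma exists_smul_of_mem_rootSpace {α : Weight ℂ H g} (hα : α.IsNonZero) {x y : g}
    (hx : x ∈ rootSpace H α) (hx0 : x ≠ 0) (hy : y ∈ rootSpace H α) : ∃ c : ℂ, y = c • x := by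
  obtain ⟨c, hc⟩ := (finrank_eq_one_iff_of_nonzero' (⟨x, hx⟩ : rootSpace H α)
    (by simpa using hx0)).mp (finrank_rootSpace_eq_one α hα) ⟨y, hy⟩
  exact ⟨c, by simpa using (congrArg Subtype.val hc).symm⟩

/-- This is sl₂-theory on the root string through β. The triple is taken for -α, so that f spans
g_α. Starting from the top v of the (-α)-string, f^n v spans g_β, and f^(n+1) v is still nonzero
because the string continues to α + β. -/
lemma lie_ne_zero_of_rootSpace_add_ne_bot {α β : Weight ℂ H g} (hα : α.IsNonZero)
    (hβ : β.IsNonZero) (hαβ : rootSpace H (α + β : H → ℂ) ≠ ⊥) {x y : g}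
    (hx : x ∈ rootSpace H α) (hy : y ∈ rootSpace H β) (hx0 : x ≠ 0) (hy0 : y ≠ 0) :
    ⁅x, y⁆ ≠ 0 := by
  obtain ⟨v, hv, hv0⟩ := (chainTop (-α) β).exists_ne_zero
  obtain ⟨h, e, f, t, he, hf⟩ := exists_isSl2Triple_of_weight_isNonZero hα.neg
  obtain rfl := t.h_eq_coroot hα.neg he hf
  have prim : t.HasPrimitiveVectorWith v (chainLength (-α) β : ℂ) :=
    have := lie_mem_genWeightSpace_of_mem_genWeightSpace he hv
    ⟨hv0, (chainLength_smul _ _ hv).symm, by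
      rwa [genWeightSpace_add_chainTop _ _ hα.neg] at this⟩
  have hbot : 1 ≤ chainBotCoeff (-α : Weight ℂ H g) β := by
    have := (rootSpace_zsmul_add_ne_bot_iff (-α) β hα.neg (-1)).1 (by simpa using hαβ)
    simpa using this.2
  have hlen := chainTopCoeff_add_chainBotCoeff (-α) β
  set n := chainTopCoeff (-α : Weight ℂ H g) β with hn
  have h1 := prim.pow_toEnd_f_ne_zero_of_eq_nat rfl
    (show n + 1 ≤ chainLength (-α) β by lia)
  have h2 : ((toEnd ℂ g g f) ^ n) v ∈ rootSpace H β := by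
    have := toEnd_pow_apply_mem hf hv n
    convert! this using 2
    rw [coe_chainTop, ← hn, smul_neg, natCast_zsmul, neg_add_cancel_left]
  have hf' : f ∈ rootSpace H α := by simpa using hf
  obtain ⟨c, hc⟩ := exists_smul_of_mem_rootSpace hα hx hx0 hf'
  obtain ⟨d, hd⟩ := exists_smul_of_mem_rootSpace hβ hy hy0 h2
  intro h0
  apply h1
  rw [pow_succ', Module.End.mul_apply, hd, hc]
  simp [h0]

lemma lie_ne_zero_of_root_add_eq {α β δ : H.root}
    (h : (rootSystem H).root δ = (rootSystem H).root α + (rootSystem H).root β) {x y : g}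
    (hx : x ∈ rootSpace H (α : Weight ℂ H g)) (hy : y ∈ rootSpace H (β : Weight ℂ H g))
    (hx0 : x ≠ 0) (hy0 : y ≠ 0) : ⁅x, y⁆ ≠ 0 := by
  refine lie_ne_zero_of_rootSpace_add_ne_bot (H.isNonZero_coe_root α) (H.isNonZero_coe_root β)
    ?_ hx hy hx0 hy0
  have : ((α : Weight ℂ H g) + (β : Weight ℂ H g) : H → ℂ) = (δ : Weight ℂ H g) := by
    ext z
    simpa using (LinearMap.congr_fun h z).symm
  rw [this]
  exact (δ : Weight ℂ H g).genWeightSpace_ne_bot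

/-- The vectors on which `H` acts through the linear form `φ`. -/
def IsWeightVector (H : LieSubalgebra ℂ g) (φ : Dual ℂ H) (x : g) : Prop :=
  ∀ h : H, ⁅(h : g), x⁆ = φ h • x

lemma IsWeightVector.lie {φ ψ : Dual ℂ H} {x y : g} (hx : IsWeightVector H φ x)
    (hy : IsWeightVector H ψ y) : IsWeightVector H (φ + ψ) ⁅x, y⁆ := by
  intro h
  rw [leibniz_lie, hx, hy, smul_lie, lie_smul, ← add_smul, LinearMap.add_apply]

lemma IsWeightVector.mem_genWeightSpace {φ : Dual ℂ H} {x : g} (hx : IsWeightVector H φ x) :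
    x ∈ rootSpace H (φ : H → ℂ) := by
  exact (LieModule.mem_genWeightSpace _ _ _).2 fun h ↦ ⟨1, by simpa [sub_eq_zero] using hx h⟩

lemma isWeightVector_of_mem_rootSpace {α : H.root} {x : g}
    (hx : x ∈ rootSpace H (α : Weight ℂ H g)) :
    IsWeightVector H ((rootSystem H).root α) x :=
  fun h ↦ lie_eq_smul_of_mem_rootSpace hx h

lemma IsWeightVector.mem_rootSpace {α : H.root} {x : g}
    (hx : IsWeightVector H ((rootSystem H).root α) x) : x ∈ rootSpace H (α : Weight ℂ H g) :=
  hx.mem_genWeightSpace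

lemma IsWeightVector.exists_root {φ : Dual ℂ H} {x : g} (hx : IsWeightVector H φ x) (h0 : x ≠ 0)
    (hφ : φ ≠ 0) : ∃ α : H.root, (rootSystem H).root α = φ := by
  have hb : rootSpace H (φ : H → ℂ) ≠ ⊥ := by
    intro h
    have := hx.mem_genWeightSpace
    rw [h] at this
    exact h0 (by simpa using this)
  let w : Weight ℂ H g := ⟨φ, hb⟩
  have hw : w.IsNonZero := by
    intro h
    apply hφ
    ext z
    exact congrFun h z
  refine ⟨⟨w, by simpa using hw⟩, ?_⟩
  ext z
  rfl

lemma IsWeightVector.eq_zero {φ : Dual ℂ H} {x : g} (hx : IsWeightVector H φ x) (hφ : φ ≠ 0)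
    (h : φ ∉ Set.range (rootSystem H).root) : x = 0 := by
  by_contra h0
  exact h (hx.exists_root h0 hφ)

lemma RootVectors.isWeightVector (X : RootVectors H) (α : H.root) :
    IsWeightVector H ((rootSystem H).root α) (X.vec α) :=
  isWeightVector_of_mem_rootSpace (X.vec_mem α (H.isNonZero_coe_root α))

lemma exists_neg_root (α : H.root) :
    ∃ β : H.root, (β : Weight ℂ H g) = -(α : Weight ℂ H g) ∧
      (rootSystem H).root β = -(rootSystem H).root α :=
  ⟨⟨-α, by simpa using H.isNonZero_coe_root α⟩, rfl, by ext; simp⟩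

/-! ### Highest roots of irreducible root systems -/

section RootPairing

open RootPairing

variable {ι K M N : Type*} [Finite ι] [Field K] [CharZero K] [AddCommGroup M] [Module K M]
  [AddCommGroup N] [Module K N] {P : RootPairing ι K M N} [P.IsCrystallographic]

lemma pairingIn_eq_sum {s : Finset ι} {f : ι → ℤ} {i : ι}
    (h : P.root i = ∑ j ∈ s, f j • P.root j) (k : ι) :
    P.pairingIn ℤ i k = ∑ j ∈ s, f j * P.pairingIn ℤ j k := by
  apply FaithfulSMul.algebraMap_injective ℤ K
  simp_rw [algebraMap_pairingIn, map_sum, ← root_coroot_eq_pairing, h, map_sum, map_zsmul,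
    LinearMap.coe_sum, Finset.sum_apply, LinearMap.smul_apply, root_coroot_eq_pairing,
    zsmul_eq_mul, map_mul, algebraMap_pairingIn, eq_intCast]

/-- A dominant positive root has full support. Otherwise dominance makes the simple roots in its
support orthogonal to those outside, so the span of the support is stable under all simple
reflections, against irreducibility. -/
lemma exists_coeff_pos_of_dominant [P.IsReduced] [P.IsIrreducible] (b : P.Base) {i : ι}
    (hi : b.IsPos i) (hdom : ∀ k ∈ b.support, 0 ≤ P.pairingIn ℤ i k) :
    ∃ f : ι → ℤ, (∀ k ∈ b.support, 0 < f k) ∧ P.root i = ∑ j ∈ b.support, f j • P.root j := by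
  obtain ⟨f, -, hf, hsum⟩ := b.exists_root_eq_sum_int i
  have hf0 : 0 < f := by
    refine hf.resolve_right fun h ↦ ?_
    have h1 := (b.isPos_iff).1 hi
    rw [Base.height_eq_sum hsum] at h1
    exact h1.not_ge (Finset.sum_nonpos fun j _ ↦ h.le j)
  refine ⟨f, ?_, hsum⟩
  by_contra! hcon
  obtain ⟨k, hk, hfk⟩ := hcon
  have hfk : f k = 0 := le_antisymm hfk (hf0.le k)
  set S : Set ι := {j | j ∈ b.support ∧ f j ≠ 0} with hS
  have hinv : ∀ l ∈ b.support,
      Submodule.span K (P.root '' S) ∈ End.invtSubmodule (P.reflection l).toLinearMap := by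
    intro l hl
    by_cases hlS : l ∈ S
    · exact Submodule.mem_invtSubmodule_reflection_of_mem _ _
        (Submodule.subset_span ⟨l, hlS, rfl⟩)
    have hfl : f l = 0 := by
      by_contra h
      exact hlS ⟨hl, h⟩
    have hterm : ∀ j ∈ b.support, f j * P.pairingIn ℤ j l ≤ 0 := by
      intro j hj
      rcases eq_or_ne j l with rfl | hjl
      · simp [hfl]
      · exact mul_nonpos_of_nonneg_of_nonpos (hf0.le j) (b.pairingIn_le_zero_of_ne hjl hj hl)
    -- The terms are nonpositive and their sum is nonnegative by dominance, so each one vanishes.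
    have hzero : ∀ j ∈ b.support, f j * P.pairingIn ℤ j l = 0 := by
      have h0 : 0 ≤ ∑ j ∈ b.support, f j * P.pairingIn ℤ j l := by
        rw [← pairingIn_eq_sum hsum]
        exact hdom l hl
      exact (Finset.sum_eq_zero_iff_of_nonpos hterm).1
        (le_antisymm (Finset.sum_nonpos hterm) h0)
    rw [End.mem_invtSubmodule, Submodule.span_le]
    rintro - ⟨j, ⟨hj, hfj⟩, rfl⟩
    have hjl : P.pairingIn ℤ j l = 0 := (mul_eq_zero.1 (hzero j hj)).resolve_left hfj
    have : P.reflection l (P.root j) = P.root j := by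
      rw [P.reflection_apply_root' ℤ, hjl, zero_smul, sub_zero]
    change P.reflection l (P.root j) ∈ Submodule.span K (P.root '' S)
    rw [this]
    exact Submodule.subset_span ⟨j, ⟨hj, hfj⟩, rfl⟩
  have hne : Submodule.span K (P.root '' S) ≠ ⊥ := by
    intro h
    apply P.ne_zero i
    rw [hsum]
    refine Finset.sum_eq_zero fun j hj ↦ ?_
    by_cases hfj : f j = 0
    · simp [hfj]
    · have : P.root j ∈ Submodule.span K (P.root '' S) := Submodule.subset_span ⟨j, ⟨hj, hfj⟩, rfl⟩
      rw [h, Submodule.mem_bot] at this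
      simp [this]
  have htop := IsIrreducible.eq_top_of_invtSubmodule_reflection (P := P) _
    ((b.forall_mem_support_invtSubmodule_iff _).1 hinv) hne
  have hmem : P.root k ∈ Submodule.span K (P.root '' S) := htop ▸ Submodule.mem_top
  have hli : LinearIndepOn K P.root (insert k S) := by
    refine b.linearIndepOn_root.mono ?_
    rintro j (rfl | hj)
    exacts [hk, hj.1]
  exact ((linearIndepOn_insert (fun h : k ∈ S ↦ h.2 hfk)).1 hli).2 hmem

/-- An irreducible root system has at most one highest root. -/
lemma eq_of_forall_root_add_notMem [P.IsReduced] [P.IsIrreducible] (b : P.Base) {i j : ι}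
    (hi : b.IsPos i) (hj : b.IsPos j)
    (hi' : ∀ k, b.IsPos k → P.root i + P.root k ∉ Set.range P.root)
    (hj' : ∀ k, b.IsPos k → P.root j + P.root k ∉ Set.range P.root) : i = j := by
  let := P.indexNeg
  have dom {l : ι} (hl : b.IsPos l)
      (hl' : ∀ k, b.IsPos k → P.root l + P.root k ∉ Set.range P.root) (k : ι)
      (hk : k ∈ b.support) : 0 ≤ P.pairingIn ℤ l k := by
    by_contra! h
    have hk' := b.isPos_of_mem_support hk
    refine hl' k hk' (P.root_add_root_mem_of_pairingIn_neg h fun e ↦ ?_)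
    have e' : l = -k := by
      apply P.root.injective
      simpa using e
    rw [e'] at hl
    exact (Base.IsPos.neg_iff_not b k).1 hl hk'
  obtain ⟨f, hf, hsum⟩ := exists_coeff_pos_of_dominant b hj (dom hj hj')
  -- All coefficients of j are positive, i pairs nonnegatively with each simple root, and positively
  -- with at least one.
  have hpos : 0 < P.pairingIn ℤ j i := by
    rw [pairingIn_eq_sum hsum]
    obtain ⟨k, hk, hk'⟩ := hi.exists_mem_support_pos_pairingIn
    refine Finset.sum_pos' (fun l hl ↦ mul_nonneg (hf l hl).le ?_)
      ⟨k, hk, mul_pos (hf k hk) hk'⟩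
    by_contra! h
    exact (dom hi hi' l hl).not_gt ((P.pairingIn_lt_zero_iff ℤ).1 h)
  -- The difference of the two roots would now be a root, and, up to sign, adding it raises one of
  -- them to the other.
  by_contra hij
  obtain ⟨k, hk⟩ := P.root_sub_root_mem_of_pairingIn_pos hpos (Ne.symm hij)
  rcases Base.IsPos.or_neg b k with h | h
  · exact hi' k h ⟨j, by rw [hk]; abel⟩
  · refine hj' (-k) h ⟨i, ?_⟩
    have : P.root (-k) = -P.root k := by simp
    rw [this, hk]; abel

end RootPairing

/-! ### Lengths of roots -/

lemma two_mul_root_apply_cartanEquivDual_symm (α β : H.root) :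
    2 * (rootSystem H).root β ((cartanEquivDual H).symm ((rootSystem H).root α)) =
      ((rootSystem H).pairingIn ℤ β α : ℂ) *
        (rootSystem H).root α ((cartanEquivDual H).symm ((rootSystem H).root α)) := by
  have h0 := root_apply_cartanEquivDual_symm_ne_zero (H.isNonZero_coe_root α)
  have h1 : ((rootSystem H).pairingIn ℤ β α : ℂ) = (rootSystem H).root β (coroot (α : Weight ℂ H g)) :=
    (rootSystem H).algebraMap_pairingIn ℤ β α
  rw [h1, coroot]
  simp only [rootSystem_root_apply, map_nsmul, map_smul, smul_eq_mul, nsmul_eq_mul] at h0 ⊢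
  simp only [Weight.toLinear_apply] at h0 ⊢
  field_simp
  ring

lemma killingForm_cartanEquivDual_symm (φ : Dual ℂ H) (h : H) :
    killingForm ℂ g ((cartanEquivDual H).symm φ) h = φ h := by
  have : cartanEquivDual H ((cartanEquivDual H).symm φ) h = φ h := by
    rw [LinearEquiv.apply_symm_apply]
  exact this

/-- With c = (α, α), the Killing form gives c = ∑ (β, α)² over all roots β, and 2(β, α) = ⟨β, α^∨⟩
c. Hence c = 4 / ∑ ⟨β, α^∨⟩². This justifies the real part in `rootNormSq`. -/
lemma exists_root_apply_eq_ofReal (α : H.root) : ∃ r : ℝ, 0 < r ∧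
    (rootSystem H).root α ((cartanEquivDual H).symm ((rootSystem H).root α)) = r := by
  set t := (cartanEquivDual H).symm ((rootSystem H).root α) with ht
  set c := (rootSystem H).root α t with hc
  have hc0 : c ≠ 0 := root_apply_cartanEquivDual_symm_ne_zero (H.isNonZero_coe_root α)
  have h1 : c = ∑ β : H.root, (rootSystem H).root β t * (rootSystem H).root β t := by
    have h2 := killingForm_cartanEquivDual_symm ((rootSystem H).root α) t
    have h3 : (rootSystem H).CorootForm t t = killingForm ℂ g t t := by
      rw [corootForm_rootSystem_eq_killing]; rfl
    rw [← ht, ← h3, RootPairing.corootForm_apply_apply] at h2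
    exact h2.symm
  set s : ℤ := ∑ β : H.root, (rootSystem H).pairingIn ℤ β α ^ 2 with hs
  have h4 : 4 * c = (s : ℂ) * c ^ 2 := by
    nth_rw 1 [h1]
    rw [hs, Finset.mul_sum, Int.cast_sum, Finset.sum_mul]
    refine Finset.sum_congr rfl fun β _ ↦ ?_
    have := two_mul_root_apply_cartanEquivDual_symm α β
    rw [← ht, ← hc] at this
    push_cast
    linear_combination (2 * (rootSystem H).root β t + ((rootSystem H).pairingIn ℤ β α : ℂ) * c) * this
  have hs0 : 0 < s := by
    refine Finset.sum_pos' (fun _ _ ↦ sq_nonneg _) ⟨α, Finset.mem_univ _, ?_⟩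
    simp
  have h5 : c = ((4 / s : ℝ) : ℂ) := by
    have hs' : (s : ℂ) ≠ 0 := by exact_mod_cast hs0.ne'
    push_cast
    rw [eq_div_iff hs']
    apply mul_right_cancel₀ hc0
    linear_combination -h4
  exact ⟨4 / s, by positivity, h5⟩

lemma rootNormSq_pos (α : H.root) : 0 < rootNormSq α := by
  obtain ⟨r, hr, h⟩ := exists_root_apply_eq_ofReal α
  rw [rootNormSq, killingForm_cartanEquivDual_symm, h]
  simpa using hr

/-- Both sides are 2(α, β). The identity turns comparisons of lengths into comparisons of pairings.
-/
lemma pairingIn_mul_rootNormSq (α β : H.root) :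
    ((rootSystem H).pairingIn ℤ β α : ℝ) * rootNormSq α =
      (rootSystem H).pairingIn ℤ α β * rootNormSq β := by
  obtain ⟨r, hr, h⟩ := exists_root_apply_eq_ofReal α
  obtain ⟨s, hs, h'⟩ := exists_root_apply_eq_ofReal β
  have h1 := two_mul_root_apply_cartanEquivDual_symm α β
  have h2 := two_mul_root_apply_cartanEquivDual_symm β α
  have h3 : (rootSystem H).root β ((cartanEquivDual H).symm ((rootSystem H).root α)) =
      (rootSystem H).root α ((cartanEquivDual H).symm ((rootSystem H).root β)) := by
    rw [← killingForm_cartanEquivDual_symm, ← killingForm_cartanEquivDual_symm,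
      LieModule.traceForm_comm]
  rw [rootNormSq, rootNormSq, killingForm_cartanEquivDual_symm, killingForm_cartanEquivDual_symm,
    h, h', Complex.ofReal_re, Complex.ofReal_re]
  rw [h] at h1
  rw [h'] at h2
  have : ((rootSystem H).pairingIn ℤ β α : ℂ) * r = (rootSystem H).pairingIn ℤ α β * s := by
    rw [← h1, ← h2, h3]
  exact_mod_cast this

/-- A root other than `±α` pairs with a long root `α` to `-1`, `0` or `1`. -/
lemma IsLong.abs_pairingIn_le_one {α β : H.root} (hα : IsLong α) (h : β ≠ α)
    (h' : (rootSystem H).root β ≠ -(rootSystem H).root α) :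
    |(rootSystem H).pairingIn ℤ β α| ≤ 1 := by
  have h1 := (rootSystem H).pairingIn_pairingIn_mem_set_of_isCrystal_of_isRed' β α
    (fun e ↦ h ((rootSystem H).root.injective e)) h'
  have h2 := pairingIn_mul_rootNormSq α β
  have h3 := rootNormSq_pos α
  have h4 := hα β
  simp only [Set.mem_insert_iff, Set.mem_singleton_iff, Prod.mk.injEq] at h1
  -- In the list of possible pairs, ⟨β, α^∨⟩ = ±2 or ±3 comes with ⟨α, β^∨⟩ = ±1, which would make β
  -- longer than α.
  rcases h1 with h1 | h1 | h1 | h1 | h1 | h1 | h1 | h1 | h1 | h1 | h1 <;>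
    rw [h1.1, h1.2] at h2 <;> rw [h1.1] <;> push_cast at h2 <;>
    first
    | (exfalso; linarith)
    | norm_num

/-! ### The degree of a root -/

section Degree

variable {b : (rootSystem H).Base} {q : b.support}

lemma IsWeightVector.mem_piece {φ : Dual ℂ H} {x : g} (hx : IsWeightVector H φ x) {j : ℤ}
    (h : φ (gradingElement b q) = j) : x ∈ piece b q j := by
  rw [QuasiHeisenberg.mem_piece, hx, h]

lemma IsWeightVector.apply_gradingElement {φ : Dual ℂ H} {x : g} (hx : IsWeightVector H φ x)
    (h0 : x ≠ 0) {j : ℤ} (h : x ∈ piece b q j) : φ (gradingElement b q) = j := by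
  rw [QuasiHeisenberg.mem_piece, hx] at h
  exact smul_left_injective ℂ h0 h

lemma mem_rootsOfPiece_iff {j : ℤ} {α : H.root} :
    α ∈ rootsOfPiece b q j ↔ (rootSystem H).root α (gradingElement b q) = j := by
  refine ⟨fun h ↦ ?_, fun h x hx ↦ (isWeightVector_of_mem_rootSpace hx).mem_piece h⟩
  obtain ⟨x, hx, hx0⟩ := (α : Weight ℂ H g).exists_ne_zero
  exact (isWeightVector_of_mem_rootSpace hx).apply_gradingElement hx0 (h hx)

lemma root_gradingElement_of_mem_support (q : b.support) {k : H.root} (hk : k ∈ b.support) :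
    (rootSystem H).root k (gradingElement b q) = 0 ∨
      (rootSystem H).root k (gradingElement b q) = 1 := by
  classical
  have : (rootSystem H).root k = b.toWeightBasis ⟨k, hk⟩ :=
    (b.toWeightBasis_apply ⟨k, hk⟩).symm
  rw [root_gradingElement, this, Basis.repr_self, Finsupp.single_apply]
  split_ifs <;> simp

lemma exists_nat_root_gradingElement (q : b.support) {α : H.root} (hα : b.IsPos α) :
    ∃ n : ℕ, (rootSystem H).root α (gradingElement b q) = n := by
  refine hα.induction_on_add (p := fun α ↦ ∃ n : ℕ, (rootSystem H).root α (gradingElement b q) = n)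
    ?_ ?_
  · intro k hk
    rcases root_gradingElement_of_mem_support q hk with h | h
    exacts [⟨0, by rw [h]; simp⟩, ⟨1, by rw [h]; simp⟩]
  · rintro i j k hk ⟨n, hn⟩ hj
    rw [hk, LinearMap.add_apply, hn]
    rcases root_gradingElement_of_mem_support q hj with h | h
    exacts [⟨n, by rw [h]; simp⟩, ⟨n + 1, by rw [h]; simp⟩]

lemma isPos_of_root_gradingElement {α : H.root} {j : ℤ} (hj : 0 < j)
    (h : (rootSystem H).root α (gradingElement b q) = j) : b.IsPos α := by
  let := (rootSystem H).indexNeg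
  refine (RootPairing.Base.IsPos.or_neg b α).resolve_right fun h' ↦ ?_
  obtain ⟨n, hn⟩ := exists_nat_root_gradingElement q h'
  have e : (rootSystem H).root (-α) = -(rootSystem H).root α := by
    rw [RootPairing.indexNeg_neg, RootPairing.root_reflectionPerm,
      RootPairing.reflection_apply_self]
  rw [e, LinearMap.neg_apply, h] at hn
  have : -j = (n : ℤ) := by exact_mod_cast hn
  lia

/-- The pieces of nonzero degree are spanned by root vectors. -/
lemma piece_le_span (X : RootVectors H) {j : ℤ} (hj : j ≠ 0) {x : g} (hx : x ∈ piece b q j) :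
    x ∈ Submodule.span ℂ {y | ∃ α ∈ rootsOfPiece b q j, y = X.vec (α : Weight ℂ H g)} := by
  set S := Submodule.span ℂ {y | ∃ α ∈ rootsOfPiece b q j, y = X.vec (α : Weight ℂ H g)} with hS
  set f : End ℂ g := ad ℂ g (gradingElement b q : g) with hf
  have hmem {c : ℂ} {y : g} : y ∈ f.eigenspace c ↔ ⁅(gradingElement b q : g), y⁆ = c • y := by
    rw [End.mem_eigenspace_iff]; rfl
  -- Each weight space of `H` lies either in `S` or in an eigenspace for another eigenvalue; the
  -- zero weight falls in the second case since j ≠ 0. Independence of eigenspaces then removes the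
  -- second summand.
  have hle : (⊤ : Submodule ℂ g) ≤ S ⊔ ⨆ c : ℂ, ⨆ (_ : c ≠ j), f.eigenspace c := by
    have htop := iSup_genWeightSpace_eq_top ℂ H g
    rw [← LieSubmodule.toSubmodule_inj, LieSubmodule.iSup_toSubmodule,
      LieSubmodule.top_toSubmodule] at htop
    rw [← htop]
    refine iSup_le fun χ y hy ↦ ?_
    have hy' : ⁅(gradingElement b q : g), y⁆ = χ (gradingElement b q) • y :=
      lie_eq_smul_of_mem_rootSpace hy (gradingElement b q)
    by_cases hc : χ (gradingElement b q) = j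
    · refine Submodule.mem_sup_left ?_
      rcases eq_or_ne y 0 with rfl | hy0
      · exact zero_mem _
      have hχ : genWeightSpace g χ ≠ ⊥ := by
        intro h
        rw [h] at hy
        exact hy0 (by simpa using hy)
      let w : Weight ℂ H g := ⟨χ, hχ⟩
      have hw : w.IsNonZero := by
        intro h
        have h1 := congrFun h (gradingElement b q)
        change χ (gradingElement b q) = 0 at h1
        rw [hc] at h1
        exact hj (by exact_mod_cast h1)
      let α : H.root := ⟨w, by simpa using hw⟩
      obtain ⟨c, rfl⟩ := exists_smul_of_mem_rootSpace hw (X.vec_mem w hw) (X.vec_ne_zero hw) hy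
      exact S.smul_mem _ (Submodule.subset_span ⟨α, mem_rootsOfPiece_iff.2 hc, rfl⟩)
    · exact Submodule.mem_sup_right
        (Submodule.mem_iSup_of_mem _ (Submodule.mem_iSup_of_mem hc (hmem.2 hy')))
  obtain ⟨s, hs, r, hr, rfl⟩ := Submodule.mem_sup.1 (hle (Submodule.mem_top (x := x)))
  have hs' : s ∈ f.eigenspace j := by
    have : S ≤ f.eigenspace j := by
      rw [hS, Submodule.span_le]
      rintro - ⟨α, hα, rfl⟩
      exact hmem.2 (mem_piece.1 (hα (X.vec_mem α (H.isNonZero_coe_root α))))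
    exact this hs
  have hr' : r ∈ f.eigenspace j := by
    have := Submodule.sub_mem _ (hmem.2 (mem_piece.1 hx)) hs'
    simpa using this
  have hr0 : r = 0 := by
    have := (f.eigenspaces_iSupIndep (j : ℂ)).le_bot ⟨hr', hr⟩
    simpa using this
  rw [hr0, add_zero]
  exact hs

end Degree

/-! ### Roots of degree at least three -/

section Radical

variable {b : (rootSystem H).Base} {q : b.support}

lemma mem_nilradical_of_mem_piece {j : ℤ} (hj : 0 < j) {x : g} (hx : x ∈ piece b q j) :
    x ∈ nilradical b q := by
  change x ∈ (⨆ j : ℕ, (piece b q (j + 1)).toSubmodule)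
  obtain ⟨n, rfl⟩ : ∃ n : ℕ, j = n + 1 := ⟨(j - 1).toNat, by lia⟩
  exact Submodule.mem_iSup_of_mem n hx

lemma lie_mem_nilradical {z x : g} (hz : z ∈ piece b q 0) (hx : x ∈ nilradical b q) :
    ⁅z, x⁆ ∈ nilradical b q := by
  change x ∈ (⨆ j : ℕ, (piece b q (j + 1)).toSubmodule) at hx
  induction hx using Submodule.iSup_induction' with
  | zero => simp
  | add x₁ x₂ _ _ h₁ h₂ => rw [lie_add]; exact add_mem h₁ h₂
  | mem i x hx =>
    have := lie_mem_piece hz hx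
    rw [zero_add] at this
    exact mem_nilradical_of_mem_piece (by lia) this

lemma lie_lie_eq_zero_of_isQuasiHeisenberg (hq : IsQuasiHeisenberg (nilradical b q)) {x y z : g}
    (hx : x ∈ nilradical b q) (hy : y ∈ nilradical b q) (hz : z ∈ nilradical b q) :
    ⁅x, ⁅y, z⁆⁆ = 0 := by
  have h : ⁅(⟨x, hx⟩ : nilradical b q), ⁅(⟨y, hy⟩ : nilradical b q), (⟨z, hz⟩ : nilradical b q)⁆⁆ ∈
      ⁅(⊤ : LieIdeal ℂ (nilradical b q)), ⁅(⊤ : LieIdeal ℂ (nilradical b q)),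
        (⊤ : LieIdeal ℂ (nilradical b q))⁆⁆ :=
    LieSubmodule.lie_mem_lie (LieSubmodule.mem_top _)
      (LieSubmodule.lie_mem_lie (LieSubmodule.mem_top _) (LieSubmodule.mem_top _))
  rw [hq.1, LieSubmodule.mem_bot] at h
  simpa using congrArg Subtype.val h

/-- The linear span of the brackets of elements of the nilradical. -/
def bracketSpan (b : (rootSystem H).Base) (q : b.support) : Submodule ℂ g :=
  Submodule.span ℂ {w | ∃ y ∈ nilradical b q, ∃ z ∈ nilradical b q, w = ⁅y, z⁆}

lemma lie_mem_bracketSpan {z x : g} (hz : z ∈ piece b q 0) (hx : x ∈ bracketSpan b q) :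
    ⁅z, x⁆ ∈ bracketSpan b q := by
  rw [bracketSpan] at hx
  induction hx using Submodule.span_induction with
  | zero => simp
  | add x y _ _ h₁ h₂ => rw [lie_add]; exact add_mem h₁ h₂
  | smul c x _ h => rw [lie_smul]; exact Submodule.smul_mem _ _ h
  | mem x hx =>
    obtain ⟨y, hy, w, hw, rfl⟩ := hx
    rw [leibniz_lie]
    exact add_mem (Submodule.subset_span ⟨_, lie_mem_nilradical hz hy, _, hw, rfl⟩)
      (Submodule.subset_span ⟨_, hy, _, lie_mem_nilradical hz hw, rfl⟩)

lemma lie_eq_zero_of_mem_bracketSpan (hq : IsQuasiHeisenberg (nilradical b q)) {x y : g}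
    (hx : x ∈ nilradical b q) (hy : y ∈ bracketSpan b q) : ⁅x, y⁆ = 0 := by
  rw [bracketSpan] at hy
  induction hy using Submodule.span_induction with
  | zero => simp
  | add x y _ _ h₁ h₂ => rw [lie_add, h₁, h₂, add_zero]
  | smul c x _ h => rw [lie_smul, h, smul_zero]
  | mem w hw =>
    obtain ⟨y, hy, z, hz, rfl⟩ := hw
    exact lie_lie_eq_zero_of_isQuasiHeisenberg hq hx hy hz

/-- Build α by adding simple roots. Up to a scalar, X_α is the bracket of the last simple root
vector with the preceding root vector: a simple root of degree 0 preserves the span of brackets, and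
one of degree 1 leaves the other factor in degree n + 1 ≥ 1, so both factors lie in n. -/
lemma vec_mem_bracketSpan (X : RootVectors H) (q : b.support) {α : H.root} (hα : b.IsPos α) (n : ℕ)
    (h : (rootSystem H).root α (gradingElement b q) = ((n + 2 : ℕ) : ℂ)) :
    X.vec α ∈ bracketSpan b q := by
  revert n
  refine hα.induction_on_add (p := fun α ↦ ∀ n : ℕ,
    (rootSystem H).root α (gradingElement b q) = ((n + 2 : ℕ) : ℂ) →
      X.vec α ∈ bracketSpan b q) ?_ ?_
  · intro k hk n hn
    rcases root_gradingElement_of_mem_support q hk with h | h <;> rw [h] at hn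
    · norm_cast at hn
    · norm_cast at hn
      lia
  · intro i j k hk ih hj n hn
    have hw := lie_ne_zero_of_root_add_eq (hk.trans (add_comm _ _))
      (X.vec_mem j (H.isNonZero_coe_root j)) (X.vec_mem i (H.isNonZero_coe_root i))
      (X.vec_ne_zero (H.isNonZero_coe_root j)) (X.vec_ne_zero (H.isNonZero_coe_root i))
    have hmem : ⁅X.vec j, X.vec i⁆ ∈ rootSpace H (k : Weight ℂ H g) := by
      apply IsWeightVector.mem_rootSpace
      rw [hk, add_comm]
      exact (X.isWeightVector j).lie (X.isWeightVector i)
    obtain ⟨c, hc⟩ := exists_smul_of_mem_rootSpace (H.isNonZero_coe_root k) hmem hw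
      (X.vec_mem k (H.isNonZero_coe_root k))
    rw [hc]
    refine Submodule.smul_mem _ _ ?_
    have hdeg := hn
    rw [hk, LinearMap.add_apply] at hdeg
    rcases root_gradingElement_of_mem_support q hj with hdj | hdj <;> rw [hdj] at hdeg
    · refine lie_mem_bracketSpan ((X.isWeightVector j).mem_piece (by simpa using hdj)) (ih n ?_)
      rw [← hdeg, add_zero]
    · refine Submodule.subset_span ⟨_, mem_nilradical_of_mem_piece (j := 1) one_pos
        ((X.isWeightVector j).mem_piece (by simpa using hdj)), _,
        mem_nilradical_of_mem_piece (j := n + 1) (by lia)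
        ((X.isWeightVector i).mem_piece ?_), rfl⟩
      push_cast at hdeg ⊢
      linear_combination hdeg

/-- In the quasi-Heisenberg case no root has degree greater than two. -/
lemma root_gradingElement_ne_of_isPos (X : RootVectors H) (hq : IsQuasiHeisenberg (nilradical b q))
    {α : H.root} (hα : b.IsPos α) (n : ℕ) :
    (rootSystem H).root α (gradingElement b q) ≠ ((n + 3 : ℕ) : ℂ) := by
  revert n
  refine hα.induction_on_add (p := fun α ↦ ∀ n : ℕ,
    (rootSystem H).root α (gradingElement b q) ≠ ((n + 3 : ℕ) : ℂ)) ?_ ?_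
  · intro k hk n hn
    rcases root_gradingElement_of_mem_support q hk with h | h <;> rw [h] at hn
    · norm_cast at hn
    · norm_cast at hn
      lia
  · intro i j k hk ih hj n hn
    have hw := lie_ne_zero_of_root_add_eq (hk.trans (add_comm _ _))
      (X.vec_mem j (H.isNonZero_coe_root j)) (X.vec_mem i (H.isNonZero_coe_root i))
      (X.vec_ne_zero (H.isNonZero_coe_root j)) (X.vec_ne_zero (H.isNonZero_coe_root i))
    rw [hk, LinearMap.add_apply] at hn
    rcases root_gradingElement_of_mem_support q hj with hdj | hdj <;> rw [hdj] at hn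
    · exact ih n (by rw [← hn, add_zero])
    · have hdi : (rootSystem H).root i (gradingElement b q) = ((n + 2 : ℕ) : ℂ) := by
        push_cast at hn ⊢
        linear_combination hn
      -- The step from degree n + 2 to n + 3 brackets n with [n, n], giving zero, although the sum
      -- of the two roots is a root.
      exact hw (lie_eq_zero_of_mem_bracketSpan hq (mem_nilradical_of_mem_piece (j := 1) one_pos
        ((X.isWeightVector j).mem_piece (by simpa using hdj)))
        (vec_mem_bracketSpan X q (isPos_of_root_gradingElement (j := n + 2) (by lia)
          (by rw [hdi]; push_cast; rfl)) n hdi))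

lemma root_gradingElement_le_two (X : RootVectors H) (hq : IsQuasiHeisenberg (nilradical b q))
    {α : H.root} {j : ℤ} (h : (rootSystem H).root α (gradingElement b q) = j) : j ≤ 2 := by
  by_contra! hj
  obtain ⟨n, rfl⟩ : ∃ n : ℕ, j = n + 3 := ⟨(j - 3).toNat, by lia⟩
  exact root_gradingElement_ne_of_isPos X hq (isPos_of_root_gradingElement (by lia) h) n
    (by rw [h]; push_cast; rfl)

end Radical

/-! ### Coefficients of elements of `l ⊗ z(n)` -/

section Coeff

variable {b : (rootSystem H).Base} {q : b.support}

/-- The contraction `a ⊗ w ↦ κ(u, w) a` from `l ⊗ z(n)` to `l`. -/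
def coeff (b : (rootSystem H).Base) (q : b.support) (u : g) : LeviTensor b q →ₗ[ℂ] levi b q :=
  TensorProduct.lift <| LinearMap.mk₂ ℂ (fun a w ↦ killingForm ℂ g u (w : g) • a)
    (by intros; rw [smul_add]) (by intros; rw [smul_comm])
    (by intros; simp [add_smul]) (by intros; simp [mul_smul])

lemma coeff_tmul (u : g) (a : levi b q) (w : piece b q 2) :
    coeff b q u (a ⊗ₜ w) = killingForm ℂ g u (w : g) • a := by
  simp [coeff]

lemma coeff_smul (c : ℂ) (u : g) (v : LeviTensor b q) :
    coeff b q (c • u) v = c • coeff b q u v := by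
  induction v using TensorProduct.induction_on with
  | zero => simp
  | tmul a w => simp [coeff_tmul, mul_smul]
  | add x y hx hy => rw [map_add, hx, hy, map_add, smul_add]

lemma coeff_add (u u' : g) (v : LeviTensor b q) :
    coeff b q (u + u') v = coeff b q u v + coeff b q u' v := by
  induction v using TensorProduct.induction_on with
  | zero => simp
  | tmul a w => simp [coeff_tmul, add_smul]
  | add x y hx hy => rw [map_add, hx, hy, map_add, map_add]; abel

lemma coeff_zero (v : LeviTensor b q) : coeff b q 0 v = 0 := by
  simpa using coeff_smul (0 : ℂ) 0 v

/-- Invariance of the Killing form moves the action on the second factor onto u. -/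
lemma coeff_lie (u : g) (z : levi b q) (v : LeviTensor b q) :
    coeff b q u ⁅z, v⁆ = ⁅z, coeff b q u v⁆ - coeff b q ⁅(z : g), u⁆ v := by
  induction v using TensorProduct.induction_on with
  | zero => simp
  | tmul a w =>
    have h : killingForm ℂ g u ⁅(z : g), (w : g)⁆ = -killingForm ℂ g ⁅(z : g), u⁆ (w : g) := by
      rw [← lie_skew (z : g) u, map_neg, LinearMap.neg_apply, neg_neg]
      exact (LieModule.traceForm_apply_lie_apply ℂ g g u z w).symm
    rw [TensorProduct.LieModule.lie_tmul_right, map_add, coeff_tmul, coeff_tmul, coeff_tmul,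
      coeff_tmul, lie_smul]
    have h' : ((⁅z, w⁆ : piece b q 2) : g) = ⁅(z : g), (w : g)⁆ := rfl
    rw [h', h, neg_smul, sub_eq_add_neg]
  | add x y hx hy => rw [lie_add, map_add, map_add, hx, hy, lie_add, map_add]; abel

lemma RootVectors.killing_neg_self (X : RootVectors H) (γ : H.root) :
    killingForm ℂ g (X.vec (-(γ : Weight ℂ H g))) (X.vec γ) = 1 := by
  rw [LieModule.traceForm_comm]
  exact X.killing γ (H.isNonZero_coe_root γ)

lemma RootVectors.killing_neg_of_ne (X : RootVectors H) {γ δ : H.root} (h : γ ≠ δ) :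
    killingForm ℂ g (X.vec (-(γ : Weight ℂ H g))) (X.vec δ) = 0 := by
  refine killingForm_apply_eq_zero_of_mem_rootSpace_of_add_ne_zero ℂ g H
    (X.vec_mem _ (H.isNonZero_coe_root γ).neg) (X.vec_mem _ (H.isNonZero_coe_root δ)) fun e ↦ h ?_
  apply Subtype.ext
  ext z
  have := congrFun e z
  simp only [Weight.coe_neg, Pi.add_apply, Pi.neg_apply, Pi.zero_apply] at this
  linear_combination -this

-- The normalisation κ(X_γ, X_{-γ}) = 1 makes the X_{-γ} the Killing-dual basis to the X_γ in g(2).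
open Classical in
lemma sum_killing_smul_vec (X : RootVectors H) {w : g} (hw : w ∈ piece b q 2) :
    ∑ γ : rootsOfPiece b q 2, killingForm ℂ g (X.vec (-(γ : H.root))) w • X.vec (γ : H.root) = w := by
  have := piece_le_span X two_ne_zero hw
  clear hw
  induction this using Submodule.span_induction with
  | zero => simp
  | add x y _ _ hx hy => simp only [map_add, add_smul, Finset.sum_add_distrib, hx, hy]
  | smul c x _ hx =>
    simp only [map_smul, smul_eq_mul, mul_smul]
    rw [← Finset.smul_sum, hx]
  | mem x hx =>
    obtain ⟨α, hα, rfl⟩ := hx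
    rw [Finset.sum_eq_single (⟨α, hα⟩ : rootsOfPiece b q 2)]
    · rw [X.killing_neg_self, one_smul]
    · intro γ _ hγ
      rw [X.killing_neg_of_ne (fun e ↦ hγ (Subtype.ext e)), zero_smul]
    · simp

/-- An element of `l ⊗ z(n)` is determined by its coefficients. -/
lemma eq_zero_of_coeff_eq_zero (X : RootVectors H) {v : LeviTensor b q}
    (h : ∀ γ ∈ rootsOfPiece b q 2, coeff b q (X.vec (-(γ : Weight ℂ H g))) v = 0) : v = 0 := by
  classical
  have key (v : LeviTensor b q) : v = ∑ γ : rootsOfPiece b q 2,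
      coeff b q (X.vec (-(γ : H.root))) v ⊗ₜ[ℂ] X.inPiece γ.2 := by
    induction v using TensorProduct.induction_on with
    | zero => simp
    | tmul a w =>
      simp only [coeff_tmul, TensorProduct.smul_tmul]
      rw [← TensorProduct.tmul_sum]
      congr 1
      apply Subtype.ext
      rw [AddSubmonoidClass.coe_finsetSum]
      exact (sum_killing_smul_vec X w.2).symm
    | add x y hx hy =>
      simp only [map_add, TensorProduct.add_tmul, Finset.sum_add_distrib]
      rw [← hx, ← hy]
  rw [key v]
  refine Finset.sum_eq_zero fun γ _ ↦ ?_
  rw [h γ γ.2, TensorProduct.zero_tmul]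

lemma coeff_tau2_of_mem_rootsOfPiece (X : RootVectors H) (x : piece b q 1) {γ : H.root}
    (hγ : γ ∈ rootsOfPiece b q 2) :
    (coeff b q (X.vec (-(γ : Weight ℂ H g))) (tau2 X b q x) : g) =
      (1 / 2 : ℂ) • ⁅(x : g), ⁅(x : g), X.vec (-(γ : Weight ℂ H g))⁆⁆ := by
  classical
  rw [tau2_apply, map_smul, map_sum, Finset.sum_eq_single (⟨γ, hγ⟩ : rootsOfPiece b q 2)]
  · rw [coeff_tmul]
    simp [RootVectors.inPiece, X.killing_neg_self]
  · intro δ _ hδ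
    rw [coeff_tmul]
    simp only [RootVectors.inPiece]
    rw [X.killing_neg_of_ne (fun e ↦ hδ (Subtype.ext e.symm)), zero_smul]
  · simp

/-- The contraction of `τ₂(x)` with `u ∈ g(-2)` is `ad(x)² u / 2`. -/
lemma coeff_tau2 (X : RootVectors H) (x : piece b q 1) {u : g} (hu : u ∈ piece b q (-2)) :
    (coeff b q u (tau2 X b q x) : g) = (1 / 2 : ℂ) • ⁅(x : g), ⁅(x : g), u⁆⁆ := by
  have := piece_le_span X (by norm_num) hu
  clear hu
  induction this using Submodule.span_induction with
  | zero => simp [coeff_zero]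
  | add y z _ _ hy hz =>
    rw [coeff_add]
    simp [hy, hz]
  | smul c y _ hy =>
    rw [coeff_smul]
    simp only [SetLike.val_smul, hy, lie_smul]
    rw [smul_comm]
  | mem y hy =>
    obtain ⟨δ, hδ, rfl⟩ := hy
    obtain ⟨γ, hγ, hγ'⟩ := exists_neg_root δ
    have hγ2 : γ ∈ rootsOfPiece b q 2 := by
      rw [mem_rootsOfPiece_iff] at hδ ⊢
      rw [hγ', LinearMap.neg_apply, hδ]
      simp
    have h := coeff_tau2_of_mem_rootsOfPiece X x hγ2
    rw [hγ, neg_neg] at h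
    exact h

end Coeff

/-! ### Pairings of the roots attached to a special constituent -/

section Pairings

variable {b : (rootSystem H).Base} {q : b.support}

lemma pairingIn_cast (α k : H.root) :
    ((rootSystem H).pairingIn ℤ α k : ℂ) = (rootSystem H).root α ((rootSystem H).coroot k) :=
  (rootSystem H).algebraMap_pairingIn ℤ α k

lemma pairingIn_add {α β δ : H.root}
    (h : (rootSystem H).root δ = (rootSystem H).root α + (rootSystem H).root β) (k : H.root) :
    (rootSystem H).pairingIn ℤ δ k =
      (rootSystem H).pairingIn ℤ α k + (rootSystem H).pairingIn ℤ β k := by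
  have : ((rootSystem H).pairingIn ℤ δ k : ℂ) =
      (rootSystem H).pairingIn ℤ α k + (rootSystem H).pairingIn ℤ β k := by
    rw [pairingIn_cast, pairingIn_cast, pairingIn_cast, h, LinearMap.add_apply]
  exact_mod_cast this

lemma pairingIn_neg {α β : H.root} (h : (rootSystem H).root β = -(rootSystem H).root α)
    (k : H.root) : (rootSystem H).pairingIn ℤ β k = -(rootSystem H).pairingIn ℤ α k := by
  have : ((rootSystem H).pairingIn ℤ β k : ℂ) = -(rootSystem H).pairingIn ℤ α k := by
    rw [pairingIn_cast, pairingIn_cast, h, LinearMap.neg_apply]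
  exact_mod_cast this

lemma pairingIn_add_eq_add {α β γ δ : H.root}
    (h : (rootSystem H).root α + (rootSystem H).root β =
      (rootSystem H).root γ + (rootSystem H).root δ) (k : H.root) :
    (rootSystem H).pairingIn ℤ α k + (rootSystem H).pairingIn ℤ β k =
      (rootSystem H).pairingIn ℤ γ k + (rootSystem H).pairingIn ℤ δ k := by
  have : ((rootSystem H).pairingIn ℤ α k : ℂ) + (rootSystem H).pairingIn ℤ β k =
      (rootSystem H).pairingIn ℤ γ k + (rootSystem H).pairingIn ℤ δ k := by
    rw [pairingIn_cast, pairingIn_cast, pairingIn_cast, pairingIn_cast, ← LinearMap.add_apply, h,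
      LinearMap.add_apply]
  exact_mod_cast this

lemma linearForm_ne_of_gradingElement {φ ψ : Dual ℂ H} {i j : ℤ}
    (hφ : φ (gradingElement b q) = i) (hψ : ψ (gradingElement b q) = j) (hij : i ≠ j) : φ ≠ ψ := by
  rintro rfl
  rw [hφ] at hψ
  exact hij (by exact_mod_cast hψ)

/-- A root whose degree is not `±1` pairs with a long root of degree one to `-1`, `0` or `1`. -/
lemma IsLong.abs_pairingIn_le_one_of_degree {μ δ : H.root} (hμ : IsLong μ)
    (hμ1 : (rootSystem H).root μ (gradingElement b q) = (1 : ℤ)) {j : ℤ}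
    (hδ : (rootSystem H).root δ (gradingElement b q) = j) (h1 : j ≠ 1) (h2 : j ≠ -1) :
    |(rootSystem H).pairingIn ℤ δ μ| ≤ 1 := by
  refine hμ.abs_pairingIn_le_one ?_ ?_
  · rintro rfl
    exact linearForm_ne_of_gradingElement hδ hμ1 h1 rfl
  · exact linearForm_ne_of_gradingElement hδ (j := -1)
      (by rw [LinearMap.neg_apply, hμ1]; push_cast; rfl) h2

lemma pairingIn_nonneg_of_add_notMem {α β : H.root}
    (h : (rootSystem H).root α + (rootSystem H).root β ∉ Set.range (rootSystem H).root)
    (h' : (rootSystem H).root α ≠ -(rootSystem H).root β) :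
    0 ≤ (rootSystem H).pairingIn ℤ α β := by
  by_contra! hneg
  exact h ((rootSystem H).root_add_root_mem_of_pairingIn_neg hneg h')

/-- Pairing β + γ = μ + ε with μ^∨ gives ⟨β, μ^∨⟩ + ⟨γ, μ^∨⟩ = 2 + ⟨ε, μ^∨⟩. The left side is at
most 2, since β and γ have degrees 0 and 2 and μ is long; the right side is at least 2, since μ + ε
is not a root. Equality holds throughout. -/
lemma pairingIn_eq_of_isLong {μ ε γ β : H.root} (hμ : IsLong μ)
    (hμ1 : (rootSystem H).root μ (gradingElement b q) = (1 : ℤ))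
    (hε1 : (rootSystem H).root ε (gradingElement b q) = (1 : ℤ))
    (hγ2 : (rootSystem H).root γ (gradingElement b q) = (2 : ℤ))
    (hsum : (rootSystem H).root μ + (rootSystem H).root ε ∉ Set.range (rootSystem H).root)
    (hβ : (rootSystem H).root β + (rootSystem H).root γ =
      (rootSystem H).root μ + (rootSystem H).root ε) :
    (rootSystem H).pairingIn ℤ ε μ = 0 ∧ (rootSystem H).pairingIn ℤ γ μ = 1 ∧
      (rootSystem H).pairingIn ℤ β μ = 1 := by
  have hβ0 : (rootSystem H).root β (gradingElement b q) = (0 : ℤ) := by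
    have := LinearMap.congr_fun hβ (gradingElement b q)
    rw [LinearMap.add_apply, LinearMap.add_apply, hμ1, hε1, hγ2] at this
    push_cast at this ⊢
    linear_combination this
  have h1 := abs_le.1 (hμ.abs_pairingIn_le_one_of_degree hμ1 hβ0 (by norm_num) (by norm_num))
  have h2 := abs_le.1 (hμ.abs_pairingIn_le_one_of_degree hμ1 hγ2 (by norm_num) (by norm_num))
  have h3 : 0 ≤ (rootSystem H).pairingIn ℤ ε μ := by
    refine pairingIn_nonneg_of_add_notMem (by rwa [add_comm]) ?_
    exact linearForm_ne_of_gradingElement hε1 (j := -1)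
      (by rw [LinearMap.neg_apply, hμ1]; push_cast; rfl) (by norm_num)
  have h4 := pairingIn_add_eq_add hβ μ
  rw [RootPairing.pairingIn_same] at h4
  lia

/-- If `ε + α` is a root, then `μ` pairs positively with `α`. -/
lemma pairingIn_pos_of_isType1a {μ ε γ β α δ : H.root} (htype : IsType1a μ ε)
    (hμ1 : (rootSystem H).root μ (gradingElement b q) = (1 : ℤ))
    (hε1 : (rootSystem H).root ε (gradingElement b q) = (1 : ℤ))
    (hγ2 : (rootSystem H).root γ (gradingElement b q) = (2 : ℤ))
    (hα0 : (rootSystem H).root α (gradingElement b q) = (0 : ℤ))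
    (hβ : (rootSystem H).root β + (rootSystem H).root γ =
      (rootSystem H).root μ + (rootSystem H).root ε)
    (hδ : (rootSystem H).root δ = (rootSystem H).root ε + (rootSystem H).root α)
    (hμα : (rootSystem H).root μ + (rootSystem H).root α ∉ Set.range (rootSystem H).root)
    (hγα : (rootSystem H).root γ + (rootSystem H).root α ∉ Set.range (rootSystem H).root)
    (hβα : (rootSystem H).pairingIn ℤ γ α = 0 →
      (rootSystem H).root β + (rootSystem H).root α ∉ Set.range (rootSystem H).root) :
    0 < (rootSystem H).pairingIn ℤ μ α := by
  obtain ⟨hsum, -, hμ, hε⟩ := htype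
  obtain ⟨-, -, hβμ⟩ := pairingIn_eq_of_isLong hμ hμ1 hε1 hγ2 hsum hβ
  have hnegα : (-(rootSystem H).root α) (gradingElement b q) = (0 : ℤ) := by
    rw [LinearMap.neg_apply, hα0]; simp
  by_contra! hcon
  have hμα0 : (rootSystem H).pairingIn ℤ μ α = 0 :=
    le_antisymm hcon (pairingIn_nonneg_of_add_notMem hμα
      (linearForm_ne_of_gradingElement hμ1 hnegα (by norm_num)))
  have hαμ0 : (rootSystem H).pairingIn ℤ α μ = 0 :=
    (rootSystem H).pairingIn_eq_zero_iff.1 hμα0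
  have hδ1 : (rootSystem H).root δ (gradingElement b q) = (1 : ℤ) := by
    rw [hδ, LinearMap.add_apply, hε1, hα0]; push_cast; ring
  -- Since ε is long, both ⟨α, ε^∨⟩ and ⟨ε + α, ε^∨⟩ = 2 + ⟨α, ε^∨⟩ lie between -1 and 1.
  have hαε : (rootSystem H).pairingIn ℤ α ε = -1 := by
    have h1 := abs_le.1 (hε.abs_pairingIn_le_one_of_degree hε1 hα0 (by norm_num) (by norm_num))
    have h2 : δ ≠ ε := by
      rintro rfl
      exact (rootSystem H).ne_zero α (left_eq_add.1 hδ)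
    have h3 := abs_le.1 (hε.abs_pairingIn_le_one h2
      (linearForm_ne_of_gradingElement hδ1 (j := -1)
        (by rw [LinearMap.neg_apply, hε1]; push_cast; rfl) (by norm_num)))
    have h4 := pairingIn_add hδ ε
    rw [RootPairing.pairingIn_same] at h4
    lia
  have hεα : (rootSystem H).pairingIn ℤ ε α < 0 :=
    ((rootSystem H).pairingIn_lt_zero_iff ℤ).1 (by rw [hαε]; norm_num)
  have hγα0 : 0 ≤ (rootSystem H).pairingIn ℤ γ α := pairingIn_nonneg_of_add_notMem hγα
    (linearForm_ne_of_gradingElement hγ2 hnegα (by norm_num))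
  have hrel := pairingIn_add_eq_add hβ α
  have hβneg : (rootSystem H).root β ≠ -(rootSystem H).root α := by
    intro h
    have := pairingIn_neg h μ
    lia
  have hβne : β ≠ α := by
    rintro rfl
    rw [RootPairing.pairingIn_same] at hrel
    lia
  -- Under the assumption ⟨μ, α^∨⟩ = 0, ⟨β, α^∨⟩ = ⟨ε, α^∨⟩ - ⟨γ, α^∨⟩ is negative. If ⟨γ, α^∨⟩ = 0,
  -- then β + α is a root, which is excluded. Otherwise ⟨β, α^∨⟩ is strictly below ⟨ε, α^∨⟩ ≤ -1; as
  -- both pairings with α are then negated ratios of squared lengths to that of α, β would be longer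
  -- than the long root ε.
  rcases hγα0.eq_or_lt with h0 | h0
  · exact hβα h0.symm ((rootSystem H).root_add_root_mem_of_pairingIn_neg (by lia) hβneg)
  have hset := (rootSystem H).pairingIn_pairingIn_mem_set_of_isCrystal_of_isRed' β α
    (fun e ↦ hβne ((rootSystem H).root.injective e)) hβneg
  have hαβ : (rootSystem H).pairingIn ℤ α β = -1 := by
    simp only [Set.mem_insert_iff, Set.mem_singleton_iff, Prod.mk.injEq] at hset
    lia
  have n1 := pairingIn_mul_rootNormSq α β
  have n2 := pairingIn_mul_rootNormSq α ε
  have n3 := hε β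
  have n4 := rootNormSq_pos α
  rw [hαβ] at n1
  rw [hαε] at n2
  have h5 : ((rootSystem H).pairingIn ℤ β α : ℝ) + 1 ≤ (rootSystem H).pairingIn ℤ ε α := by
    exact_mod_cast (by lia : (rootSystem H).pairingIn ℤ β α + 1 ≤ (rootSystem H).pairingIn ℤ ε α)
  push_cast at n1 n2
  nlinarith

end Pairings

/-! ### Highest weight vectors of `l ⊗ z(n)` -/

section HighestWeightVectors

variable {b : (rootSystem H).Base} {q : b.support}

lemma coe_mem_levi (h : H) : (h : g) ∈ levi b q := by
  rw [mem_levi]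
  have : ⁅gradingElement b q, h⁆ = 0 := trivial_lie_zero _ _ _ _
  simpa using congrArg Subtype.val this

lemma IsWeightVector.mem_levi {φ : Dual ℂ H} {x : g} (hx : IsWeightVector H φ x)
    (h : φ (gradingElement b q) = 0) : x ∈ levi b q := by
  rw [QuasiHeisenberg.mem_levi, hx, h, zero_smul]

lemma root_gradingElement_of_mem_levi {α : H.root} {z : g} (hz : z ∈ levi b q) (h0 : z ≠ 0)
    (hα : z ∈ rootSpace H (α : Weight ℂ H g)) :
    (rootSystem H).root α (gradingElement b q) = 0 := by
  rw [mem_levi, isWeightVector_of_mem_rootSpace hα] at hz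
  exact (smul_eq_zero.1 hz).resolve_right h0

section Module

variable {M : Type*} [AddCommGroup M] [Module ℂ M] [LieRingModule (levi b q) M]
  [LieModule ℂ (levi b q) M]

lemma isHighestWeightVector_coe_iff {V : LieSubmodule ℂ (levi b q) M} {v : V} {ν : Dual ℂ H} :
    IsHighestWeightVector b q (v : M) ν ↔ IsHighestWeightVector b q v ν := by
  constructor
  · intro h
    refine ⟨fun e ↦ h.ne_zero (by rw [e]; rfl), fun z t hz ↦ Subtype.ext ?_,
      fun z α hα hz ↦ Subtype.ext ?_⟩
    exacts [h.weight z t hz, h.annihilated z α hα hz]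
  · intro h
    refine ⟨fun e ↦ h.ne_zero (Subtype.ext e), fun z t hz ↦ ?_, fun z α hα hz ↦ ?_⟩
    exacts [congrArg Subtype.val (h.weight z t hz), congrArg Subtype.val (h.annihilated z α hα hz)]

end Module

/-- If μ + α were a root, X_α would not annihilate the highest weight vector, which spans g_μ. -/
lemma add_notMem_range_of_hasHighestWeight (X : RootVectors H) {j : ℤ} {μ α : H.root}
    (h : HasHighestWeight b q (piece b q j) ((rootSystem H).root μ)) (hα : b.IsPos α)
    (hα0 : (rootSystem H).root α (gradingElement b q) = 0) :
    (rootSystem H).root μ + (rootSystem H).root α ∉ Set.range (rootSystem H).root := by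
  rintro ⟨δ, hδ⟩
  obtain ⟨w, hw⟩ := h
  have hwμ : IsWeightVector H ((rootSystem H).root μ) (w : g) := fun t ↦
    congrArg Subtype.val (hw.weight ⟨t, coe_mem_levi t⟩ t rfl)
  have hXα := X.vec_mem α (H.isNonZero_coe_root α)
  refine lie_ne_zero_of_root_add_eq (hδ.trans (add_comm _ _)) hXα hwμ.mem_rootSpace
    (X.vec_ne_zero (H.isNonZero_coe_root α)) (fun e ↦ hw.ne_zero (Subtype.ext e)) ?_
  exact congrArg Subtype.val
    (hw.annihilated ⟨X.vec α, (X.isWeightVector α).mem_levi hα0⟩ α hα hXα)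

/-- In the quasi-Heisenberg case the highest weight of `z(n)` is the highest root. -/
lemma add_notMem_range_of_isQuasiHeisenberg (X : RootVectors H)
    (hq : IsQuasiHeisenberg (nilradical b q)) {δ : H.root} (hδ : δ ∈ rootsOfPiece b q 2)
    (h : ∀ α, b.IsPos α → (rootSystem H).root α (gradingElement b q) = 0 →
      (rootSystem H).root δ + (rootSystem H).root α ∉ Set.range (rootSystem H).root)
    {α : H.root} (hα : b.IsPos α) :
    (rootSystem H).root δ + (rootSystem H).root α ∉ Set.range (rootSystem H).root := by
  intro hr
  obtain ⟨σ, hσ⟩ := hr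
  obtain ⟨n, hn⟩ := exists_nat_root_gradingElement q hα
  rw [mem_rootsOfPiece_iff] at hδ
  have := root_gradingElement_le_two X hq (α := σ) (j := 2 + n)
    (by rw [hσ, LinearMap.add_apply, hδ, hn]; push_cast; rfl)
  obtain rfl : n = 0 := by lia
  exact h α hα (by simpa using hn) ⟨σ, hσ⟩

/-- An element of `l ⊗ z(n)` annihilated by the positive root vectors of `l` vanishes as soon as
its lowest coefficient does. -/
lemma eq_zero_of_coeff_highest_eq_zero (X : RootVectors H)
    (hq : IsQuasiHeisenberg (nilradical b q)) {γ : H.root} (hγ : γ ∈ rootsOfPiece b q 2)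
    (hhigh : HasHighestWeight b q (piece b q 2) ((rootSystem H).root γ)) {v : LeviTensor b q}
    (hv : ∀ (z : levi b q) (α : H.root), b.IsPos α →
      (z : g) ∈ rootSpace H (α : Weight ℂ H g) → ⁅z, v⁆ = 0)
    (h : coeff b q (X.vec (-(γ : Weight ℂ H g))) v = 0) : v = 0 := by
  refine eq_zero_of_coeff_eq_zero X ?_
  by_contra! hcon
  -- Take γ' of maximal height with nonzero contraction. It differs from γ, so by uniqueness of the
  -- highest root it can be raised by a positive root α of l to some δ, whose contraction vanishes
  -- by maximality.
  obtain ⟨γ', ⟨hγ'2, hγ'0⟩, hmax⟩ := Set.exists_max_image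
    {δ : H.root | δ ∈ rootsOfPiece b q 2 ∧ coeff b q (X.vec (-(δ : Weight ℂ H g))) v ≠ 0}
    b.height (Set.toFinite _) hcon
  have hpos {δ : H.root} (hδ : δ ∈ rootsOfPiece b q 2) : b.IsPos δ :=
    isPos_of_root_gradingElement two_pos (mem_rootsOfPiece_iff.1 hδ)
  have hex : ∃ α, b.IsPos α ∧ (rootSystem H).root α (gradingElement b q) = 0 ∧
      (rootSystem H).root γ' + (rootSystem H).root α ∈ Set.range (rootSystem H).root := by
    by_contra! hno
    have : γ' = γ := eq_of_forall_root_add_notMem b (hpos hγ'2) (hpos hγ)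
      (fun k hk ↦ add_notMem_range_of_isQuasiHeisenberg X hq hγ'2 hno hk)
      (fun k hk ↦ add_notMem_range_of_isQuasiHeisenberg X hq hγ
        (fun α hα hα0 ↦ add_notMem_range_of_hasHighestWeight X hhigh hα hα0) hk)
    exact hγ'0 (this ▸ h)
  obtain ⟨α, hα, hα0, δ, hδ⟩ := hex
  have hδ2 : δ ∈ rootsOfPiece b q 2 := by
    rw [mem_rootsOfPiece_iff] at hγ'2 ⊢
    rw [hδ, LinearMap.add_apply, hγ'2, hα0, add_zero]
  have hδ0 : coeff b q (X.vec (-(δ : Weight ℂ H g))) v = 0 := by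
    by_contra hne
    have h1 := hmax δ ⟨hδ2, hne⟩
    rw [b.height_add hδ] at h1
    have h2 := b.isPos_iff.1 hα
    lia
  obtain ⟨δ', hδ', hδ'r⟩ := exists_neg_root δ
  obtain ⟨σ, hσ, hσr⟩ := exists_neg_root γ'
  have hsum : (rootSystem H).root σ = (rootSystem H).root α + (rootSystem H).root δ' := by
    rw [hσr, hδ'r, hδ]; abel
  have hXα := X.vec_mem α (H.isNonZero_coe_root α)
  have hXδ := X.vec_mem δ' (H.isNonZero_coe_root δ')
  have hne := lie_ne_zero_of_root_add_eq hsum hXα hXδ (X.vec_ne_zero (H.isNonZero_coe_root α))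
    (X.vec_ne_zero (H.isNonZero_coe_root δ'))
  have hmem : ⁅X.vec α, X.vec δ'⁆ ∈ rootSpace H (σ : Weight ℂ H g) := by
    apply IsWeightVector.mem_rootSpace
    rw [hsum]
    exact (X.isWeightVector α).lie (X.isWeightVector δ')
  obtain ⟨c, hc⟩ := exists_smul_of_mem_rootSpace (H.isNonZero_coe_root σ) hmem hne
    (X.vec_mem σ (H.isNonZero_coe_root σ))
  -- X_{-γ'} is proportional to [X_α, X_{-δ}], and X_α kills v, so the vanishing contraction at δ
  -- forces that at γ' to vanish.
  have hz := coeff_lie (X.vec δ') ⟨X.vec α, (X.isWeightVector α).mem_levi hα0⟩ v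
  rw [hv _ α hα hXα, map_zero, hδ', hδ0, lie_zero, zero_sub, zero_eq_neg, ← hδ'] at hz
  apply hγ'0
  rw [← hσ, hc, coeff_smul, hz, smul_zero]

lemma IsHighestWeightVector.isWeightVector_coeff {v : LeviTensor b q} {ν φ : Dual ℂ H}
    (hv : IsHighestWeightVector b q v ν) {u : g} (hu : IsWeightVector H φ u) :
    IsWeightVector H (ν + φ) (coeff b q u v : g) := by
  intro t
  have h := coeff_lie u ⟨t, coe_mem_levi t⟩ v
  rw [hv.weight ⟨t, coe_mem_levi t⟩ t rfl, map_smul, hu t, coeff_smul, eq_sub_iff_add_eq,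
    ← add_smul] at h
  exact (congrArg Subtype.val h).symm

/-- If the contractions of `T` are given by `ad(X_μ) ad(X_ε)` up to a scalar and `ad(X_μ)`
annihilates `ad([z, X_ε]) g(-2)` for positive root vectors `z` of `l`, then `T` is a highest weight
vector and lies in every submodule containing a highest weight vector of the same weight. -/
lemma mem_and_isHighestWeightVector (X : RootVectors H) (hq : IsQuasiHeisenberg (nilradical b q))
    {μ ε γ β δ : H.root} (hγ : γ ∈ rootsOfPiece b q 2)
    (hμ : HasHighestWeight b q (piece b q 1) ((rootSystem H).root μ))
    (hhigh : HasHighestWeight b q (piece b q 2) ((rootSystem H).root γ))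
    (hβ : (rootSystem H).root β + (rootSystem H).root γ =
      (rootSystem H).root μ + (rootSystem H).root ε)
    (hδ : (rootSystem H).root δ = (rootSystem H).root ε - (rootSystem H).root γ)
    {T : LeviTensor b q} {c : ℂ} (hc : c ≠ 0)
    (hT : ∀ u ∈ piece b q (-2),
      (coeff b q u T : g) = c • ⁅X.vec (μ : Weight ℂ H g), ⁅X.vec (ε : Weight ℂ H g), u⁆⁆)
    (hz : ∀ z ∈ levi b q, ∀ α : H.root, b.IsPos α → z ∈ rootSpace H (α : Weight ℂ H g) →
      ∀ ρ ∈ rootsOfPiece b q (-2), ⁅X.vec (μ : Weight ℂ H g),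
        ⁅⁅z, X.vec (ε : Weight ℂ H g)⁆, X.vec (ρ : Weight ℂ H g)⁆⁆ = 0)
    {V : LieSubmodule ℂ (levi b q) (LeviTensor b q)}
    {v : LeviTensor b q} (hvV : v ∈ V)
    (hv : IsHighestWeightVector b q v
      ((rootSystem H).root μ + (rootSystem H).root ε)) :
    T ∈ V ∧ IsHighestWeightVector b q T ((rootSystem H).root μ + (rootSystem H).root ε) := by
  obtain ⟨γ', hγ', hγ'r⟩ := exists_neg_root γ
  have hpiece {ρ : H.root} (hρ : ρ ∈ rootsOfPiece b q 2) :
      X.vec (-(ρ : Weight ℂ H g)) ∈ piece b q (-2) := X.vec_neg_mem_piece hρ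
  have hlie {z : g} (hzl : z ∈ levi b q) {u : g} (hu : u ∈ piece b q (-2)) :
      ⁅z, u⁆ ∈ piece b q (-2) := (piece b q (-2)).lie_mem (x := ⟨z, hzl⟩) hu
  have hcoeff (z : levi b q) {u : g} (hu : u ∈ piece b q (-2)) :
      (coeff b q u ⁅z, T⁆ : g) = c • ⁅⁅(z : g), X.vec (μ : Weight ℂ H g)⁆,
        ⁅X.vec (ε : Weight ℂ H g), u⁆⁆ + c • ⁅X.vec (μ : Weight ℂ H g),
          ⁅⁅(z : g), X.vec (ε : Weight ℂ H g)⁆, u⁆⁆ := by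
    rw [coeff_lie, AddSubgroupClass.coe_sub, LieSubalgebra.coe_bracket, hT _ hu, hT _ (hlie z.2 hu),
      lie_smul, leibniz_lie (z : g), leibniz_lie (z : g) (X.vec (ε : Weight ℂ H g)) u, lie_add]
    module
  have hTann : ∀ (z : levi b q) (α : H.root), b.IsPos α →
      (z : g) ∈ rootSpace H (α : Weight ℂ H g) → ⁅z, T⁆ = 0 := by
    intro z α hα hzα
    rcases eq_or_ne z 0 with rfl | hz0
    · simp
    have hα0 := root_gradingElement_of_mem_levi z.2 (fun e ↦ hz0 (Subtype.ext e)) hzα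
    refine eq_zero_of_coeff_eq_zero X fun ρ hρ ↦ Subtype.ext ?_
    obtain ⟨ρ', hρ', hρ'r⟩ := exists_neg_root ρ
    have hρ'2 : ρ' ∈ rootsOfPiece b q (-2) := by
      rw [mem_rootsOfPiece_iff] at hρ ⊢
      rw [hρ'r, LinearMap.neg_apply, hρ]
      simp
    have hμz : ⁅(z : g), X.vec (μ : Weight ℂ H g)⁆ = 0 := by
      refine ((isWeightVector_of_mem_rootSpace hzα).lie (X.isWeightVector μ)).eq_zero ?_ ?_
      · intro e
        have h1 := LinearMap.congr_fun e (gradingElement b q)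
        obtain ⟨w, hw⟩ := hμ
        have hwμ : IsWeightVector H ((rootSystem H).root μ) (w : g) := fun t ↦
          congrArg Subtype.val (hw.weight ⟨t, coe_mem_levi t⟩ t rfl)
        rw [LinearMap.add_apply, hα0, hwμ.apply_gradingElement
          (fun e ↦ hw.ne_zero (Subtype.ext e)) w.2] at h1
        simp at h1
      · rw [add_comm]
        exact add_notMem_range_of_hasHighestWeight X hμ hα hα0
    rw [hcoeff z (hpiece hρ), hμz, ← hρ', hz z z.2 α hα hzα ρ' hρ'2]
    simp
  have hTweight : ∀ (z : levi b q) (t : H), (z : g) = t →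
      ⁅z, T⁆ = ((rootSystem H).root μ + (rootSystem H).root ε) t • T := by
    intro z t hzt
    rw [← sub_eq_zero]
    refine eq_zero_of_coeff_eq_zero X fun ρ hρ ↦ Subtype.ext ?_
    rw [map_sub, map_smul, AddSubgroupClass.coe_sub, hcoeff z (hpiece hρ), hzt, X.isWeightVector μ t,
      X.isWeightVector ε t, SetLike.val_smul, hT _ (hpiece hρ), smul_lie, smul_lie, lie_smul,
      LinearMap.add_apply]
    simp only [ZeroMemClass.coe_zero]
    module
  have hne : ⁅X.vec (μ : Weight ℂ H g),
      ⁅X.vec (ε : Weight ℂ H g), X.vec (-(γ : Weight ℂ H g))⁆⁆ ≠ 0 := by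
    have h0 (α : H.root) := X.vec_ne_zero (H.isNonZero_coe_root α)
    have h1 (α : H.root) := X.vec_mem α (H.isNonZero_coe_root α)
    have hδ' : (rootSystem H).root δ = (rootSystem H).root ε + (rootSystem H).root γ' := by
      rw [hδ, hγ'r]; abel
    rw [← hγ']
    have h2 : ⁅X.vec (ε : Weight ℂ H g), X.vec (γ' : Weight ℂ H g)⁆ ∈
        rootSpace H (δ : Weight ℂ H g) := by
      apply IsWeightVector.mem_rootSpace
      rw [hδ']
      exact (X.isWeightVector ε).lie (X.isWeightVector γ')
    refine lie_ne_zero_of_root_add_eq (δ := β) ?_ (h1 μ) h2 (h0 μ)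
      (lie_ne_zero_of_root_add_eq hδ' (h1 ε) (h1 γ') (h0 ε) (h0 γ'))
    rw [hδ, ← add_sub_assoc, ← hβ]; abel
  have hTγ : coeff b q (X.vec (-(γ : Weight ℂ H g))) T ≠ 0 := by
    intro h
    have := congrArg Subtype.val h
    rw [hT _ (hpiece hγ)] at this
    exact smul_ne_zero hc hne this
  have hThw : IsHighestWeightVector b q T ((rootSystem H).root μ + (rootSystem H).root ε) :=
    ⟨fun e ↦ hTγ (by rw [e, map_zero]), hTweight, hTann⟩
  refine ⟨?_, hThw⟩
  have hw {w : LeviTensor b q} (hw : IsHighestWeightVector b q w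
      ((rootSystem H).root μ + (rootSystem H).root ε)) :
      (coeff b q (X.vec (-(γ : Weight ℂ H g))) w : g) ∈ rootSpace H (β : Weight ℂ H g) := by
    apply IsWeightVector.mem_rootSpace
    have := hw.isWeightVector_coeff (X.isWeightVector γ')
    rwa [hγ'r, hγ', ← hβ, add_neg_cancel_right] at this
  have hvγ : coeff b q (X.vec (-(γ : Weight ℂ H g))) v ≠ 0 := fun h ↦
    hv.ne_zero (eq_zero_of_coeff_highest_eq_zero X hq hγ hhigh hv.annihilated h)
  -- The contractions of v and T with X_{-γ} lie on the same line g_β, so T and a multiple of v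
  -- agree there, hence everywhere.
  obtain ⟨d, hd⟩ := exists_smul_of_mem_rootSpace (H.isNonZero_coe_root β) (hw hv)
    (fun e ↦ hvγ (Subtype.ext e)) (hw hThw)
  have hTv : T - d • v = 0 := by
    refine eq_zero_of_coeff_highest_eq_zero X hq hγ hhigh ?_ (Subtype.ext ?_)
    · intro z α hα hzα
      rw [lie_sub, lie_smul, hTann z α hα hzα, hv.annihilated z α hα hzα, smul_zero, sub_zero]
    · rw [map_sub, map_smul, AddSubgroupClass.coe_sub, SetLike.val_smul, hd, sub_self]
      rfl
  rw [sub_eq_zero.1 hTv]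
  exact V.smul_mem d hvV

end HighestWeightVectors

/-! ### Special constituents -/

section Special

variable {b : (rootSystem H).Base} {q : b.support}

/-- The contraction x of v with X_{-γ} is nonzero of weight ν - γ ≠ 0, which gives β. If ⟨γ, α^∨⟩ =
0, then X_α commutes with X_{-γ}, so it kills x along with v, and β + α cannot be a root. -/
lemma exists_root_of_isHighestWeightVector (X : RootVectors H)
    (hq : IsQuasiHeisenberg (nilradical b q)) {γ : H.root} (hγ : γ ∈ rootsOfPiece b q 2)
    (hhigh : HasHighestWeight b q (piece b q 2) ((rootSystem H).root γ))
    {ν : Dual ℂ H} (hν : ν ≠ (rootSystem H).root γ) {v : LeviTensor b q}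
    (hv : IsHighestWeightVector b q v ν) :
    ∃ β : H.root, (rootSystem H).root β + (rootSystem H).root γ = ν ∧
      ∀ α, b.IsPos α → (rootSystem H).root α (gradingElement b q) = 0 →
        (rootSystem H).pairingIn ℤ γ α = 0 →
        (rootSystem H).root β + (rootSystem H).root α ∉ Set.range (rootSystem H).root := by
  obtain ⟨γ', hγ', hγ'r⟩ := exists_neg_root γ
  have hx0 : (coeff b q (X.vec (γ' : Weight ℂ H g)) v : g) ≠ 0 := by
    intro h
    rw [hγ'] at h
    exact hv.ne_zero (eq_zero_of_coeff_highest_eq_zero X hq hγ hhigh hv.annihilated (Subtype.ext h))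
  have hxw := hv.isWeightVector_coeff (X.isWeightVector γ')
  obtain ⟨β, hβ⟩ := hxw.exists_root hx0 (by rwa [hγ'r, ← sub_eq_add_neg, sub_ne_zero])
  refine ⟨β, by rw [hβ, hγ'r]; abel, fun α hα hα0 hγα hr ↦ ?_⟩
  obtain ⟨σ, hσ⟩ := hr
  have hXα := X.vec_mem α (H.isNonZero_coe_root α)
  rw [← hβ] at hxw
  refine lie_ne_zero_of_root_add_eq (hσ.trans (add_comm _ _)) hXα hxw.mem_rootSpace
    (X.vec_ne_zero (H.isNonZero_coe_root α)) hx0 ?_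
  have hz := coeff_lie (X.vec γ') ⟨X.vec α, (X.isWeightVector α).mem_levi hα0⟩ v
  have h0 : ⁅X.vec (α : Weight ℂ H g), X.vec (γ' : Weight ℂ H g)⁆ = 0 := by
    have hγ2 := mem_rootsOfPiece_iff.1 hγ
    refine ((X.isWeightVector α).lie (X.isWeightVector γ')).eq_zero ?_ ?_
    · intro e
      have h1 := LinearMap.congr_fun e (gradingElement b q)
      rw [LinearMap.add_apply, hα0, hγ'r, LinearMap.neg_apply, hγ2] at h1
      simp at h1
    · rintro ⟨ρ, hρ⟩
      -- If α - γ were a root, its reflection in α would be -(α + γ), as ⟨γ, α^∨⟩ = 0; but γ + α is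
      -- not a root.
      have h2 := pairingIn_add hρ α
      rw [RootPairing.pairingIn_same, pairingIn_neg hγ'r, hγα, neg_zero, add_zero] at h2
      obtain ⟨τ, -, hτ⟩ := exists_neg_root ((rootSystem H).reflectionPerm α ρ)
      refine add_notMem_range_of_hasHighestWeight X hhigh hα hα0 ⟨τ, ?_⟩
      rw [hτ, RootPairing.root_reflectionPerm, (rootSystem H).reflection_apply_root' ℤ, h2, hρ,
        hγ'r]
      module
  have h0' : ⁅((⟨X.vec α, (X.isWeightVector α).mem_levi hα0⟩ : levi b q) : g),
      X.vec (γ' : Weight ℂ H g)⁆ = 0 := h0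
  rw [hv.annihilated ⟨X.vec α, (X.isWeightVector α).mem_levi hα0⟩ α hα hXα, map_zero, h0',
    coeff_zero, sub_zero] at hz
  exact (congrArg Subtype.val hz).symm

/-- For a root ρ of degree -2, 2μ + ρ has degree 0 and pairs with μ^∨ to at least 4 - 1 = 3, so it
is neither zero nor a root. -/
lemma lie_lie_eq_zero_of_isLong (X : RootVectors H) {μ : H.root} (hμ : IsLong μ)
    (hμ1 : (rootSystem H).root μ (gradingElement b q) = (1 : ℤ)) {u : g}
    (hu : u ∈ piece b q (-2)) :
    ⁅X.vec (μ : Weight ℂ H g), ⁅X.vec (μ : Weight ℂ H g), u⁆⁆ = 0 := by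
  have := piece_le_span X (by norm_num) hu
  clear hu
  induction this using Submodule.span_induction with
  | zero => simp
  | add x y _ _ hx hy => rw [lie_add, lie_add, hx, hy, add_zero]
  | smul c x _ hx => rw [lie_smul, lie_smul, hx, smul_zero]
  | mem x hx =>
    obtain ⟨ρ, hρ, rfl⟩ := hx
    rw [mem_rootsOfPiece_iff] at hρ
    have h1 := abs_le.1 (hμ.abs_pairingIn_le_one_of_degree hμ1 hρ (by norm_num) (by norm_num))
    refine ((X.isWeightVector μ).lie ((X.isWeightVector μ).lie (X.isWeightVector ρ))).eq_zero ?_ ?_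
    · intro e
      have h2 := LinearMap.congr_fun e ((rootSystem H).coroot μ)
      rw [LinearMap.add_apply, LinearMap.add_apply, ← pairingIn_cast, ← pairingIn_cast,
        RootPairing.pairingIn_same, LinearMap.zero_apply] at h2
      norm_cast at h2
      lia
    · rintro ⟨σ, hσ⟩
      have h2 : (rootSystem H).pairingIn ℤ σ μ = 2 + (2 + (rootSystem H).pairingIn ℤ ρ μ) := by
        have : ((rootSystem H).pairingIn ℤ σ μ : ℂ) =
            ((2 + (2 + (rootSystem H).pairingIn ℤ ρ μ) : ℤ) : ℂ) := by
          rw [pairingIn_cast, hσ, LinearMap.add_apply, LinearMap.add_apply, ← pairingIn_cast,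
            ← pairingIn_cast, RootPairing.pairingIn_same]
          push_cast
          rfl
        exact_mod_cast this
      have h3 : (rootSystem H).root σ (gradingElement b q) = (0 : ℤ) := by
        rw [hσ, LinearMap.add_apply, LinearMap.add_apply, hμ1, hρ]
        norm_num
      have h4 := abs_le.1 (hμ.abs_pairingIn_le_one_of_degree hμ1 h3 (by norm_num) (by norm_num))
      lia

/-- If α + ε is a root, then ⟨α, μ^∨⟩ ≥ 1, while ⟨ε, μ^∨⟩ = 0 and ⟨ρ, μ^∨⟩ ≥ -1. So the weight μ + α
+ ε + ρ pairs with μ^∨ to at least 2; it is therefore nonzero, and having degree 0 it cannot be a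
root. -/
lemma lie_lie_lie_eq_zero_of_isType1a (X : RootVectors H) {μ ε γ β α ρ : H.root}
    (htype : IsType1a μ ε)
    (hμ1 : (rootSystem H).root μ (gradingElement b q) = (1 : ℤ))
    (hε1 : (rootSystem H).root ε (gradingElement b q) = (1 : ℤ))
    (hγ2 : (rootSystem H).root γ (gradingElement b q) = (2 : ℤ))
    (hα0 : (rootSystem H).root α (gradingElement b q) = (0 : ℤ))
    (hρ2 : (rootSystem H).root ρ (gradingElement b q) = (-2 : ℤ))
    (hβ : (rootSystem H).root β + (rootSystem H).root γ =
      (rootSystem H).root μ + (rootSystem H).root ε)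
    (hμα : (rootSystem H).root μ + (rootSystem H).root α ∉ Set.range (rootSystem H).root)
    (hγα : (rootSystem H).root γ + (rootSystem H).root α ∉ Set.range (rootSystem H).root)
    (hβα : (rootSystem H).pairingIn ℤ γ α = 0 →
      (rootSystem H).root β + (rootSystem H).root α ∉ Set.range (rootSystem H).root)
    {z : g} (hz : z ∈ rootSpace H (α : Weight ℂ H g)) :
    ⁅X.vec (μ : Weight ℂ H g), ⁅⁅z, X.vec (ε : Weight ℂ H g)⁆, X.vec (ρ : Weight ℂ H g)⁆⁆ = 0 := by
  have hw := (isWeightVector_of_mem_rootSpace hz).lie (X.isWeightVector ε)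
  have hαε : ((rootSystem H).root α + (rootSystem H).root ε) (gradingElement b q) = (1 : ℤ) := by
    rw [LinearMap.add_apply, hα0, hε1]; push_cast; ring
  have ne_zero_of {φ : Dual ℂ H} {j : ℤ} (h : φ (gradingElement b q) = j) (hj : j ≠ 0) : φ ≠ 0 :=
    linearForm_ne_of_gradingElement h (j := 0) (by simp) hj
  by_cases hδ : (rootSystem H).root α + (rootSystem H).root ε ∈ Set.range (rootSystem H).root
  swap
  · rw [hw.eq_zero (ne_zero_of hαε one_ne_zero) hδ]
    simp
  obtain ⟨δ, hδ⟩ := hδ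
  have hpos := pairingIn_pos_of_isType1a htype hμ1 hε1 hγ2 hα0 hβ (hδ.trans (add_comm _ _))
    hμα hγα hβα
  obtain ⟨hsum, -, hμ, hε⟩ := htype
  obtain ⟨hεμ, -, -⟩ := pairingIn_eq_of_isLong hμ hμ1 hε1 hγ2 hsum hβ
  have hαμ : 0 < (rootSystem H).pairingIn ℤ α μ := ((rootSystem H).zero_lt_pairingIn_iff' ℤ).1 hpos
  have h1 := abs_le.1 (hμ.abs_pairingIn_le_one_of_degree hμ1 hρ2 (by norm_num) (by norm_num))
  have hδμ := pairingIn_add hδ μ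
  rw [← hδ] at hw
  have hdeg : ((rootSystem H).root δ + (rootSystem H).root ρ) (gradingElement b q) = (-1 : ℤ) := by
    rw [LinearMap.add_apply, hδ, hαε, hρ2]; push_cast; ring
  have hw2 := hw.lie (X.isWeightVector ρ)
  by_cases hσ : (rootSystem H).root δ + (rootSystem H).root ρ ∈ Set.range (rootSystem H).root
  swap
  · rw [hw2.eq_zero (ne_zero_of hdeg (by norm_num)) hσ, lie_zero]
  obtain ⟨σ, hσ⟩ := hσ
  have hσμ := pairingIn_add hσ μ
  rw [← hσ] at hw2 hdeg
  refine ((X.isWeightVector μ).lie hw2).eq_zero ?_ ?_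
  · intro e
    have h2 := LinearMap.congr_fun e ((rootSystem H).coroot μ)
    rw [LinearMap.add_apply, ← pairingIn_cast, ← pairingIn_cast, RootPairing.pairingIn_same,
      LinearMap.zero_apply] at h2
    norm_cast at h2
    lia
  · rintro ⟨τ, hτ⟩
    have hτμ := pairingIn_add hτ μ
    rw [RootPairing.pairingIn_same] at hτμ
    have hτ0 : (rootSystem H).root τ (gradingElement b q) = (0 : ℤ) := by
      rw [hτ, LinearMap.add_apply, hμ1, hdeg]; push_cast; ring
    have h4 := abs_le.1 (hμ.abs_pairingIn_le_one_of_degree hμ1 hτ0 (by norm_num) (by norm_num))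
    lia

/-- The vector `τ₂(X_μ + X_ε)` is a highest weight vector of the special constituent `V(μ + ε)`
of type 1a or type 2. -/
lemma tau2_mem_and_isHighestWeightVector (hq : IsQuasiHeisenberg (nilradical b q))
    (X : RootVectors H) {μ ε γ : H.root} {V : LieSubmodule ℂ (levi b q) (LeviTensor b q)}
    (hV : IsSpecialConstituent b q V μ ε γ) (htype : IsType1a μ ε ∨ IsType2 μ ε) :
    tau2 X b q (X.inPiece hV.mu_mem + X.inPiece hV.eps_mem) ∈ V ∧
      IsHighestWeightVector b q (tau2 X b q (X.inPiece hV.mu_mem + X.inPiece hV.eps_mem))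
        ((rootSystem H).root μ + (rootSystem H).root ε) := by
  obtain ⟨v, hv⟩ := hV.highest
  rw [← isHighestWeightVector_coe_iff] at hv
  have hμ1 := mem_rootsOfPiece_iff.1 hV.mu_mem
  have hε1 := mem_rootsOfPiece_iff.1 hV.eps_mem
  have hγ : γ ∈ rootsOfPiece b q 2 := by
    obtain ⟨w, hw⟩ := hV.highest_two
    have hwγ : IsWeightVector H ((rootSystem H).root γ) (w : g) := fun t ↦
      congrArg Subtype.val (hw.weight ⟨t, coe_mem_levi t⟩ t rfl)
    exact mem_rootsOfPiece_iff.2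
      (hwγ.apply_gradingElement (fun e ↦ hw.ne_zero (Subtype.ext e)) w.2)
  have hγ2 := mem_rootsOfPiece_iff.1 hγ
  obtain ⟨β, hβ, hβα⟩ := exists_root_of_isHighestWeightVector X hq hγ hV.highest_two hV.ne hv
  have hεγ : ε ≠ γ := by
    rintro rfl
    exact linearForm_ne_of_gradingElement hε1 hγ2 (by norm_num) rfl
  have hT (u : g) (hu : u ∈ piece b q (-2)) := coeff_tau2 X
    (X.inPiece hV.mu_mem + X.inPiece hV.eps_mem) hu
  have hval : ((X.inPiece hV.mu_mem + X.inPiece hV.eps_mem : piece b q 1) : g) =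
    X.vec (μ : Weight ℂ H g) + X.vec (ε : Weight ℂ H g) := rfl
  simp only [hval] at hT
  rcases htype with htype | ⟨-, rfl⟩
  · obtain ⟨hsum, -, hμ, hε⟩ := id htype
    obtain ⟨-, hγε, -⟩ := pairingIn_eq_of_isLong hε hε1 hμ1 hγ2 (by rwa [add_comm])
      (hβ.trans (add_comm _ _))
    -- With the roles of μ and ε exchanged, ⟨γ, ε^∨⟩ = 1, so ε - γ is a root.
    obtain ⟨δ, hδ⟩ := (rootSystem H).root_sub_root_mem_of_pairingIn_pos
      (((rootSystem H).zero_lt_pairingIn_iff' ℤ).1 (hγε ▸ one_pos)) hεγ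
    refine mem_and_isHighestWeightVector X hq hγ hV.highest_one hV.highest_two hβ hδ
      (c := 1) one_ne_zero ?_ ?_ v.2 hv
    · intro u hu
      have hcomm : ⁅X.vec (ε : Weight ℂ H g), X.vec (μ : Weight ℂ H g)⁆ = 0 := by
        refine ((X.isWeightVector ε).lie (X.isWeightVector μ)).eq_zero ?_ (by rwa [add_comm])
        exact linearForm_ne_of_gradingElement (i := 2) (j := 0)
          (by rw [LinearMap.add_apply, hμ1, hε1]; norm_num) (by simp) (by norm_num)
      have hswap : ⁅X.vec (ε : Weight ℂ H g), ⁅X.vec (μ : Weight ℂ H g), u⁆⁆ =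
          ⁅X.vec (μ : Weight ℂ H g), ⁅X.vec (ε : Weight ℂ H g), u⁆⁆ := by
        rw [leibniz_lie, hcomm, zero_lie, zero_add]
      rw [hT u hu]
      simp only [add_lie, lie_add]
      rw [lie_lie_eq_zero_of_isLong X hμ hμ1 hu, lie_lie_eq_zero_of_isLong X hε hε1 hu, hswap]
      module
    · intro z hzl α hα hzα ρ hρ
      rcases eq_or_ne z 0 with rfl | hz0
      · simp
      have hα0 := root_gradingElement_of_mem_levi hzl hz0 hzα
      exact lie_lie_lie_eq_zero_of_isType1a X htype hμ1 hε1 hγ2 (by simpa using hα0)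
        (mem_rootsOfPiece_iff.1 hρ) hβ
        (add_notMem_range_of_hasHighestWeight X hV.highest_one hα hα0)
        (add_notMem_range_of_hasHighestWeight X hV.highest_two hα hα0) (hβα α hα hα0) hzα
  · have hrel := pairingIn_add_eq_add hβ ε
    have hset := (rootSystem H).pairingIn_pairingIn_mem_set_of_isCrystal_of_isRed' γ ε
      (fun e ↦ hεγ ((rootSystem H).root.injective e).symm)
      (linearForm_ne_of_gradingElement hγ2 (j := -1)
        (by rw [LinearMap.neg_apply, hε1]; push_cast; rfl) (by norm_num))
    -- Here β + γ = 2ε, so ⟨β, ε^∨⟩ = 4 - ⟨γ, ε^∨⟩ ≥ 1, because γ ≠ ±ε bounds the pairing by 3.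
    -- Hence β - ε = ε - γ is a root.
    have hβε : 0 < (rootSystem H).pairingIn ℤ β ε := by
      rw [RootPairing.pairingIn_same] at hrel
      simp only [Set.mem_insert_iff, Set.mem_singleton_iff, Prod.mk.injEq] at hset
      omega
    have hβ0 : (rootSystem H).root β (gradingElement b q) = (0 : ℤ) := by
      have := LinearMap.congr_fun hβ (gradingElement b q)
      rw [LinearMap.add_apply, LinearMap.add_apply, hε1, hγ2] at this
      push_cast at this ⊢
      linear_combination this
    obtain ⟨δ, hδ⟩ := (rootSystem H).root_sub_root_mem_of_pairingIn_pos hβε (by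
      rintro rfl
      exact linearForm_ne_of_gradingElement hβ0 hε1 (by norm_num) rfl)
    refine mem_and_isHighestWeightVector X hq hγ hV.highest_one hV.highest_two hβ (δ := δ) ?_
      -- The scalar is ½ · 2², since the argument of τ₂ is 2X_μ.
      (c := 2) two_ne_zero ?_ ?_ v.2 hv
    · rw [hδ, sub_eq_sub_iff_add_eq_add, hβ]
    · intro u hu
      rw [hT u hu]
      simp only [add_lie, lie_add]
      module
    · intro z hzl α hα hzα ρ hρ
      rcases eq_or_ne z 0 with rfl | hz0
      · simp
      have hα0 := root_gradingElement_of_mem_levi hzl hz0 hzα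
      have : ⁅z, X.vec (ε : Weight ℂ H g)⁆ = 0 := by
        refine ((isWeightVector_of_mem_rootSpace hzα).lie (X.isWeightVector ε)).eq_zero ?_ ?_
        · exact linearForm_ne_of_gradingElement (i := 1) (j := 0)
            (by rw [LinearMap.add_apply, hα0, hε1, zero_add]) (by simp) one_ne_zero
        · rw [add_comm]
          exact add_notMem_range_of_hasHighestWeight X hV.highest_one hα hα0
      rw [this]
      simp

end Special

end QuasiHeisenberg

end

open QuasiHeisenberg in
theorem proposition6p19 {g : Type*} [LieRing g] [LieAlgebra ℂ g] [FiniteDimensional ℂ g]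
    [LieAlgebra.IsSimple ℂ g] (H : LieSubalgebra ℂ g) [H.IsCartanSubalgebra]
    (b : (LieAlgebra.IsKilling.rootSystem H).Base) (q : b.support)
    (hq : IsQuasiHeisenberg (nilradical b q))
    (X : RootVectors H) (μ ε γ : H.root)
    (V : LieSubmodule ℂ (levi b q) (LeviTensor b q))
    (hV : IsSpecialConstituent b q V μ ε γ)
    (htype : IsType1a μ ε ∨ IsType2 μ ε) :
    (∃ hmem : tau2 X b q (X.inPiece hV.mu_mem + X.inPiece hV.eps_mem) ∈ V,
      IsHighestWeightVector b q
        (⟨tau2 X b q (X.inPiece hV.mu_mem + X.inPiece hV.eps_mem), hmem⟩ : V)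
        ((LieAlgebra.IsKilling.rootSystem H).root μ +
          (LieAlgebra.IsKilling.rootSystem H).root ε)) ∧
    ∀ V' : LieSubmodule ℂ (levi b q) (Module.Dual ℂ (LeviTensor b q)),
      IsDualConstituent V V' →
        (tau2Tilde X b q).domRestrict V'.toSubmodule ≠ 0 := by
  obtain ⟨hmem, hT⟩ := tau2_mem_and_isHighestWeightVector hq X hV htype
  refine ⟨⟨hmem, isHighestWeightVector_coe_iff.1 hT⟩, fun V' hV' h ↦ ?_⟩
  have h0 := (isHighestWeightVector_coe_iff (v := ⟨_, hmem⟩)).1 hT |>.ne_zero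
  rw [ne_eq, ← Module.forall_dual_apply_eq_zero_iff ℂ] at h0
  push Not at h0
  obtain ⟨f, hf⟩ := h0
  -- Only surjectivity of restriction is needed: it lifts a functional on V that is nonzero at T to
  -- an element of V*.
  obtain ⟨Y, rfl⟩ := hV'.2 f
  exact hf (congrArg (fun Q : QuadraticForm ℂ (piece b q 1) ↦
    Q (X.inPiece hV.mu_mem + X.inPiece hV.eps_mem)) (LinearMap.congr_fun h Y))
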